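/- **Setting.** Let $V$ be a finite set. An *input* consists of a directed graph $G=(V,E)$, a lazy estimate $\hat w$ with $\hat w(e)\in(0,\infty)$ for every $e\in E$, and vertices $v_{\rm source}\neq v_{\rm target}$, such that no two distinct simple paths from $v_{\rm source}$ to the same vertex have the same $\hat w$-cost. A *shortest-path problem* is an input together with a weight function $w$ such that, for every $e\in E$, $w(e)=\hat w(e)$ ($e$ is collision-free) or $w(e)=\infty$ ($e$ is in collision). The cost of a path is the sum of the weights of its edges; a shortest path (to a vertex) is a path from $v_{\rm source}$ of minimal and finite $w$-cost. **Algorithms.** A (deterministic) algorithm is given the input, and learns about $w$ only by evaluating (testing) edges $e$ one at a time, each evaluation returning $w(e)$; eventually it may report a path or failure. It belongs to the family $\mathcal{SP}$ if its state determines a tree $\mathcal T$ such that on every shortest-path problem: at every time $\mathcal T$ is a shortest-path tree rooted at $v_{\rm source}$ (for each vertex $u$ of $\mathcal T$, the path in $\mathcal T$ from $v_{\rm source}$ to $u$ is a shortest path with respect to $w$); an edge $(u,v)\in E$ is evaluated only when $u\in\mathcal T$, and only edges of $E$ are evaluated; and the algorithm terminates, reporting a shortest path from $v_{\rm source}$ to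 $v_{\rm target}$ if a collision-free path exists and failure otherwise. An algorithm is *edge-optimal* if it belongs to $\mathcal{SP}$ and, on every shortest-path problem, it tests no more edges than any other algorithm in $\mathcal{SP}$ (counting distinct edges, and likewise counting evaluations). **LRA\* with lookahead $\alpha\in\mathbb N\cup\{\infty\}$.** It maintains a lazy search tree rooted at $v_{\rm source}$. The path to each node of this tree consists of an evaluated collision-free part (head) of cost $c$ followed by an unevaluated part (tail) of $\hat w$-cost $\ell$ with $b\le\alpha$ edges. The tree is grown, in order of increasing key $c+\ell$ and without extending the target node, until every leaf that can be extended has $b=\alpha$; frontier nodes are the nodes with $b=\alpha$, and the target node once it is reached. In each iteration the frontier node of minimal key is taken and the first edge $(u,v)$ of its tail is evaluated. If it is collision-free, $v$ and its descendants are updated, and the path to $v_{\rm target}$ in the tree is reported if $v=v_{\rm target}$; if it is in collision, it is removed from the graph and the subtree of $v$ is rewired to best parents. Then the tree is extended again. If no frontier node is left, failure is reported. **LazySP** (with the forward edge selector) repeatedly takes a shortest path from $v_{\rm source}$ to $v_{\rm target}$ for the weights that equal $w$ on evaluated edges and $\hat w$ on unevaluated ones; it reports failure if there is none of finite cost, evaluates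 the first unevaluated edge of the path if there is one, and otherwise reports the path. **Theorem.** LRA\* with $\alpha=\infty$ is edge-optimal. Consequently LazySP with the forward edge selector is edge-optimal. -/

import Mathlib

open scoped ENNReal NNReal

universe u

namespace LazySearch

/-! ### Graphs, paths, costs -/

/-- `P = (v₁, …, v_k)` is a path from `a` to `b` along the directed edges in `E`. -/
def IsPath {V : Type u} (E : Finset (V × V)) (a b : V) (P : List V) : Prop :=
  P.IsChain (fun x y => (x, y) ∈ E) ∧ P.head? = some a ∧ P.getLast? = some b

/-- The edges of a path, in the order in which the path traverses them. -/
def pathEdges {V : Type u} (P : List V) : List (V × V) := P.zip P.tail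

/-- The cost of a path: the sum of the weights of its edges. -/
noncomputable def cost {V : Type u} (w : V × V → ℝ≥0∞) (P : List V) : ℝ≥0∞ :=
  ((pathEdges P).map w).sum

/-- What an algorithm is given: a directed graph, a positive lazy estimate of the edge weights, a
source and a target. No two distinct simple paths from the source to the same vertex have the same
lazy cost. -/
structure Input (V : Type u) where
  edges : Finset (V × V)
  lazyW : V × V → ℝ≥0
  source : V
  target : V
  lazyW_pos : ∀ e ∈ edges, 0 < lazyW e
  source_ne_target : source ≠ target
  no_ties : ∀ (v : V) (P Q : List V), IsPath edges source v P → IsPath edges source v Q →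
    P.Nodup → Q.Nodup →
    cost (fun e => (lazyW e : ℝ≥0∞)) P = cost (fun e => (lazyW e : ℝ≥0∞)) Q → P = Q

/-- `w` is a true weight function with lazy estimate `I.lazyW`: collision-free edges have weight
`I.lazyW e`, edges in collision have weight `∞`. A shortest-path problem is an `Input` together
with such a `w`. -/
def IsWeight {V : Type u} (I : Input V) (w : V × V → ℝ≥0∞) : Prop :=
  ∀ e ∈ I.edges, w e = (I.lazyW e : ℝ≥0∞) ∨ w e = ∞

/-- `P` is a path of minimal cost from the source to `v`, and this cost is finite. -/
def IsShortestPath {V : Type u} (I : Input V) (w : V × V → ℝ≥0∞) (v : V) (P : List V) : Prop :=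
  IsPath I.edges I.source v P ∧ cost w P < ∞ ∧
    ∀ Q, IsPath I.edges I.source v Q → cost w P ≤ cost w Q

/-! ### Algorithms that access the true weights by evaluating edges -/

/-- An algorithm either evaluates an edge or terminates with a path or with failure (`none`). -/
inductive Action (V : Type u) where
  | eval (e : V × V)
  | report (r : Option (List V))

/-- An algorithm. It depends on the true weight function only through the values that it obtains
by evaluating edges. -/
structure Algorithm (V : Type u) where
  State : Type u
  init : Input V → State
  action : Input V → State → Action V
  next : Input V → State → ℝ≥0∞ → State

namespace Algorithm

variable {V : Type u} (A : Algorithm V) (I : Input V) (w : V × V → ℝ≥0∞)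

/-- One step of the execution; a state in which the algorithm has terminated is kept. -/
def step (σ : A.State) : A.State :=
  match A.action I σ with
  | .eval e => A.next I σ (w e)
  | .report _ => σ

/-- The state after `n` steps of the execution on the problem `(I, w)`. -/
def stateAt (n : ℕ) : A.State := (A.step I w)^[n] (A.init I)

/-- The set of edges that the algorithm tests on the problem `(I, w)`. -/
def testedEdges : Set (V × V) := {e | ∃ n, A.action I (A.stateAt I w n) = .eval e}

/-- The set of times at which the algorithm evaluates an edge. -/
def evalTimes : Set ℕ := {n | ∃ e, A.action I (A.stateAt I w n) = .eval e}

end Algorithm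

/-! ### The family of algorithms that build a shortest-path tree; edge-optimality -/

/-- A set of vertices with parent pointers. -/
structure Tree (V : Type u) where
  verts : Set V
  parent : V → Option V

/-- `T` is a shortest-path tree rooted at the source for the true weights `w`: following the parent
pointers backwards from any of its vertices, one stays in `T` and traverses a shortest
collision-free path from the source to that vertex. -/
def IsShortestPathTree {V : Type u} (I : Input V) (w : V × V → ℝ≥0∞) (T : Tree V) : Prop :=
  I.source ∈ T.verts ∧ T.parent I.source = none ∧
    ∀ v ∈ T.verts, ∃ P, IsShortestPath I w v P ∧ (∀ x ∈ P, x ∈ T.verts) ∧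
      P.IsChain (fun a b => T.parent b = some a)

/-- The family of shortest-path algorithms that build a shortest-path tree: the state determines a
tree such that, on every problem, it is at every time a shortest-path tree rooted at the source,
only edges `(u, v)` of the graph with `u` in the current tree are evaluated, and the algorithm
terminates with a shortest path from the source to the target, or with failure if there is no
collision-free path. -/
def InSP {V : Type u} (A : Algorithm V) : Prop :=
  ∃ T : Input V → A.State → Tree V, ∀ (I : Input V) (w : V × V → ℝ≥0∞), IsWeight I w →
    (∀ n, IsShortestPathTree I w (T I (A.stateAt I w n))) ∧
    (∀ n e, A.action I (A.stateAt I w n) = .eval e →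
      e ∈ I.edges ∧ e.1 ∈ (T I (A.stateAt I w n)).verts) ∧
    (∃ n r, A.action I (A.stateAt I w n) = .report r) ∧
    (∀ n P, A.action I (A.stateAt I w n) = .report (some P) → IsShortestPath I w I.target P) ∧
    (∀ n, A.action I (A.stateAt I w n) = .report none → ¬ ∃ P, IsShortestPath I w I.target P)

/-- An algorithm of the family is edge-optimal if on every problem it tests no more edges than any
algorithm of the family, both when distinct edges and when calls of the weight function are
counted. -/
def EdgeOptimal {V : Type u} (A : Algorithm V) : Prop :=
  InSP A ∧ ∀ B : Algorithm V, InSP B → ∀ (I : Input V) (w : V × V → ℝ≥0∞), IsWeight I w →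
    (A.testedEdges I w).encard ≤ (B.testedEdges I w).encard ∧
    (A.evalTimes I w).encard ≤ (B.evalTimes I w).encard

/-! ### LazySP with the forward edge selector -/

/-- The weights that LazySP searches with: the true weight of an evaluated edge, the lazy estimate
of an unevaluated one. -/
noncomputable def currentWeight {V : Type u} (I : Input V) (known : V × V → Option ℝ≥0∞)
    (e : V × V) : ℝ≥0∞ :=
  (known e).getD (I.lazyW e)

open Classical in
/-- LazySP: the state records the values of the evaluated edges. Take a shortest path to the target
for the current weights; report failure if there is none, evaluate its first unevaluated edge if
there is one, and report the path otherwise. -/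
noncomputable def lazySPAction {V : Type u} (I : Input V) (known : V × V → Option ℝ≥0∞) :
    Action V :=
  if h : ∃ P, IsShortestPath I (currentWeight I known) I.target P then
    match (pathEdges h.choose).find? (fun e => (known e).isNone) with
    | some e => .eval e
    | none => .report (some h.choose)
  else .report none

noncomputable def lazySP (V : Type u) [DecidableEq V] : Algorithm V where
  State := V × V → Option ℝ≥0∞
  init _ := fun _ => none
  action := lazySPAction
  next I known x :=
    match lazySPAction I known with
    | .eval e => Function.update known e (some x)
    | .report _ => known

/-! ### Lazy Receding-Horizon A* -/

/-- The result of `while cond do body` (the initial value if the loop does not terminate). -/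
noncomputable def whileLoop {σ : Type u} (cond : σ → Prop) (body : σ → σ) (s : σ) : σ :=
  open Classical in
  if h : ∃ n, ¬ cond (body^[n] s) then body^[Nat.find h] s else s

/-- The entry of the node of a vertex: its parent, the cost `c` of the evaluated part and the lazy
cost `l` of the unevaluated part of its path, and its budget `b`, the number of unevaluated edges
of that path. -/
structure Entry (V : Type u) where
  parent : Option V
  c : ℝ≥0∞
  l : ℝ≥0∞
  b : ℕ∞

/-- The key by which all queues are ordered. -/
noncomputable def Entry.key {V : Type u} (t : Entry V) : ℝ≥0∞ := t.c + t.l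

/-- The entry `(NIL, ∞, ∞, ∞)`. -/
def Entry.unset {V : Type u} : Entry V := ⟨none, ∞, ∞, ⊤⟩

/-- The data of LRA*: the edges not yet found to be in collision, the node entries, the vertices
whose nodes are in the search tree, the four queues, and the subtree that is to be rewired. -/
structure LRAState (V : Type u) where
  E : Finset (V × V)
  node : V → Entry V
  T : Finset V
  Qfrontier : Finset V
  Qextend : Finset V
  Qupdate : Finset V
  Qrewire : Finset V
  Trewire : Finset V
  result : Option (List V)

namespace LRAState

variable {V : Type u} [Fintype V] [DecidableEq V] (I : Input V) (α : ℕ∞)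

/-- An element of minimal key of a queue; ties are broken arbitrarily. -/
noncomputable def top (s : LRAState V) (Q : Finset V) : V :=
  if h : Q.Nonempty then (Q.exists_min_image (fun v => (s.node v).key) h).choose else I.source

open Classical in
/-- The subtree of the search tree rooted at the node of `v`. -/
noncomputable def subtree (s : LRAState V) (v : V) : Finset V :=
  s.T.filter fun x => Relation.ReflTransGen (fun a b => (s.node a).parent = some b) x v

/-- The path obtained by following parent pointers backwards from `v`, for at most `n` steps. -/
def backtrack (s : LRAState V) : ℕ → V → List V
  | 0, v => [v]
  | n + 1, v =>
    match (s.node v).parent with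
    | none => [v]
    | some p => backtrack s n p ++ [v]

/-- The path in the search tree from the source to `v`. A tree path has at most `|V|` vertices. -/
def pathTo (s : LRAState V) (v : V) : List V := s.backtrack (Fintype.card V) v

/-- The entry of the node of `v` when it gets the node of `p` as its parent through an unevaluated
edge. -/
noncomputable def childEntry (s : LRAState V) (p v : V) : Entry V :=
  ⟨some p, (s.node p).c, (s.node p).l + I.lazyW (p, v), (s.node p).b + 1⟩

noncomputable def setNode (s : LRAState V) (v : V) (t : Entry V) : LRAState V :=
  { s with node := Function.update s.node v t }

/-- The edge to be evaluated: the first edge of the unevaluated part of the path to the frontier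
node of minimal key. -/
noncomputable def nextEdge (s : LRAState V) : Option (V × V) :=
  (pathEdges (s.pathTo (s.top I s.Qfrontier))).find? fun e => decide ((s.node e.2).b ≠ 0)

/-! #### Extending the α-band -/

/-- The processing of one successor `v` of the node `p` that is being extended. -/
noncomputable def extendChild (p : V) (s : LRAState V) (v : V) : LRAState V :=
  if (s.childEntry I p v).key > (s.node v).key then s
  else
    let t := s.childEntry I p v
    let s₁ : LRAState V :=
      if v ∈ s.T then
        { s with
          T := s.T \ s.subtree v
          Qfrontier := s.Qfrontier \ s.subtree v
          Qextend := s.Qextend \ s.subtree v }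
      else s
    let s₂ : LRAState V := { s₁.setNode v t with T := insert v s₁.T }
    if t.b = α then { s₂ with Qfrontier := insert v s₂.Qfrontier }
    else { s₂ with Qextend := insert v s₂.Qextend }

noncomputable def extendBody (s : LRAState V) : LRAState V :=
  let p := s.top I s.Qextend
  let s₁ : LRAState V := { s with Qextend := s.Qextend.erase p }
  if p = I.target then { s₁ with Qfrontier := insert p s₁.Qfrontier }
  else (Finset.univ.filter fun v => (p, v) ∈ s₁.E).toList.foldl (extendChild I α p) s₁

noncomputable def extendBand : LRAState V → LRAState V :=
  whileLoop (fun s => s.Qextend.Nonempty) (extendBody I α)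

/-! #### Updating the α-band after a collision-free edge -/

noncomputable def updateChild (p : V) (s : LRAState V) (v : V) : LRAState V :=
  let s₁ : LRAState V :=
    if (s.node v).b = α then { s with Qfrontier := s.Qfrontier.erase v } else s
  { s₁.setNode v (s₁.childEntry I p v) with Qupdate := insert v s₁.Qupdate }

noncomputable def updateBody (s : LRAState V) : LRAState V :=
  let p := s.top I s.Qupdate
  let s₁ : LRAState V := { s with Qupdate := s.Qupdate.erase p }
  let succ := s₁.T.filter fun v => (s₁.node v).parent = some p
  if succ = ∅ then { s₁ with Qextend := insert p s₁.Qextend }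
  else succ.toList.foldl (updateChild I α p) s₁

noncomputable def updateBand : LRAState V → LRAState V :=
  whileLoop (fun s => s.Qupdate.Nonempty) (updateBody I α)

/-! #### Rewiring the α-band after an edge in collision -/

/-- Make the node of `p` the parent of the node of `v` if this strictly decreases its key. -/
noncomputable def relax (v : V) (s : LRAState V) (p : V) : LRAState V :=
  if (s.node v).key > (s.childEntry I p v).key then s.setNode v (s.childEntry I p v) else s

/-- Reset a node of the subtree to be rewired and attach it to its best valid parent. -/
noncomputable def rewireReset (s : LRAState V) (v : V) : LRAState V :=
  let s₁ : LRAState V :=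
    { s.setNode v Entry.unset with T := s.T.erase v, Qfrontier := s.Qfrontier.erase v }
  let parents := s₁.T.filter fun p => (p, v) ∈ s₁.E ∧ (s₁.node p).b < α ∧
    p ∉ s₁.Trewire ∧ p ∉ s₁.Qextend ∧ p ≠ I.target
  let s₂ := parents.toList.foldl (relax I v) s₁
  { s₂ with Qrewire := insert v s₂.Qrewire }

noncomputable def rewireBody (s : LRAState V) : LRAState V :=
  let p := s.top I s.Qrewire
  let s₁ : LRAState V := { s with Qrewire := s.Qrewire.erase p }
  if (s₁.node p).parent = none then s₁
  else
    let s₂ : LRAState V := { s₁ with T := insert p s₁.T }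
    if (s₂.node p).b = α ∨ p = I.target then { s₂ with Qfrontier := insert p s₂.Qfrontier }
    else
      let s₃ : LRAState V :=
        if (s₂.node p).b < α then { s₂ with Qextend := insert p s₂.Qextend } else s₂
      (s₃.Qrewire.filter fun v => (p, v) ∈ s₃.E).toList.foldl (fun s v => relax I v s p) s₃

noncomputable def rewireBand (s : LRAState V) : LRAState V :=
  let s₁ := s.Trewire.toList.foldl (rewireReset I α) s
  { whileLoop (fun s => s.Qrewire.Nonempty) (rewireBody I α) s₁ with Trewire := ∅ }

/-! #### The main algorithm -/

/-- The processing of the true weight `x` of the evaluated edge `e`. -/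
noncomputable def evaluate (s : LRAState V) (e : V × V) (x : ℝ≥0∞) : LRAState V :=
  if x = I.lazyW e then
    { s.setNode e.2 ⟨some e.1, (s.node e.1).c + x, 0, 0⟩ with Qupdate := insert e.2 s.Qupdate }
  else { s with E := s.E.erase e, Trewire := s.subtree e.2 }

/-- The state at the beginning of the main loop. -/
noncomputable def start : LRAState V :=
  extendBand I α
    { E := I.edges
      node := Function.update (fun _ => Entry.unset) I.source ⟨none, 0, 0, 0⟩
      T := {I.source}
      Qfrontier := ∅
      Qextend := {I.source}
      Qupdate := ∅
      Qrewire := ∅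
      Trewire := ∅
      result := none }

/-- One iteration of the main loop, in which the edge `nextEdge` was found to have weight `x`. -/
noncomputable def iteration (s : LRAState V) (x : ℝ≥0∞) : LRAState V :=
  match s.nextEdge I with
  | none => s
  | some e =>
    let s₁ : LRAState V := { s with Qfrontier := s.Qfrontier.erase (s.top I s.Qfrontier) }
    let s₂ := s₁.evaluate I e x
    if I.target ∈ s₂.Qupdate then { s₂ with result := some (s₂.pathTo I.target) }
    else extendBand I α (rewireBand I α (updateBand I α s₂))

/-- Return the path that was found, fail if no frontier node is left, and otherwise evaluate the
next edge. -/
noncomputable def act (s : LRAState V) : Action V :=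
  match s.result with
  | some P => .report (some P)
  | none =>
    if s.Qfrontier = ∅ then .report none
    else
      match s.nextEdge I with
      | some e => .eval e
      | none => .report none

end LRAState

/-- Lazy Receding-Horizon A* (LRA*) with lookahead `α`. -/
noncomputable def LRAstar (V : Type u) [Fintype V] [DecidableEq V] (α : ℕ∞) : Algorithm V where
  State := LRAState V
  init I := LRAState.start I α
  action I s := s.act I
  next I s x := s.iteration I α x

end LazySearch

/-!
LazySP never evaluates an edge twice, so it is edge-optimal as soon as every algorithm `B` of the
family tests all the edges that LazySP tests. Let LazySP evaluate `e`, the first unevaluated edge of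
its shortest path `P`, and suppose that `B` does not test `e`. If `B` sees no collision on `P`, then
its execution does not change when all edges of `P` become collision-free, nor when `e` alone of
them is put in collision; but in the first case it has to report `P`, and in the second it must not.
Otherwise let `(u, v)` be the first edge of `P` that `B` finds to be in collision. This edge lies
behind `e`, and since `B` tests it, `B` has committed to the part of `P` up to `u` as a shortest
path. The same argument, applied to this part, gives a contradiction.

With infinite lookahead, the search tree of LRA* consists of the shortest paths for the weights that
are `∞` on the edges found to be in collision and lazy estimates elsewhere, and the only frontier
node is the target. The path to it is the one that LazySP takes, so both algorithms perform the same
actions.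
-/

namespace LazySearch

/-! ### Paths and their costs -/

section Paths

variable {V : Type u} {E : Finset (V × V)} {a b c x : V} {P A B C : List V}
  {w w' : V × V → ℝ≥0∞} {e : V × V}

@[simp] lemma pathEdges_nil : pathEdges ([] : List V) = [] := rfl

@[simp] lemma pathEdges_singleton (a : V) : pathEdges [a] = [] := rfl

@[simp] lemma pathEdges_cons_cons (a b : V) (l : List V) :
    pathEdges (a :: b :: l) = (a, b) :: pathEdges (b :: l) := rfl

lemma pathEdges_append_cons (A : List V) (x : V) (B : List V) :
    pathEdges (A ++ x :: B) = pathEdges (A ++ [x]) ++ pathEdges (x :: B) := by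
  induction A with
  | nil => simp
  | cons a A ih => cases A <;> simp_all

lemma snd_mem_of_mem_pathEdges (h : e ∈ pathEdges P) : e.2 ∈ P :=
  List.mem_of_mem_tail (List.of_mem_zip h).2

lemma isChain_iff_forall_mem_pathEdges {R : V → V → Prop} :
    P.IsChain R ↔ ∀ e ∈ pathEdges P, R e.1 e.2 := by
  induction P using List.twoStepInduction with
  | nil => simp
  | singleton a => simp
  | cons_cons a b l _ ih => simp [ih]

lemma exists_append_of_pathEdges_eq {L M : List (V × V)} (h : pathEdges P = L ++ e :: M) :
    ∃ A B, P = A ++ e.1 :: e.2 :: B ∧ pathEdges (A ++ [e.1]) = L := by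
  induction L generalizing P with
  | nil =>
    match P, h with
    | a :: b :: l, h =>
      obtain ⟨rfl, -⟩ : (a, b) = e ∧ pathEdges (b :: l) = M := by simpa using h
      exact ⟨[], l, rfl, rfl⟩
  | cons f L ih =>
    match P, h with
    | a :: b :: l, h =>
      obtain ⟨rfl, hl⟩ : (a, b) = f ∧ pathEdges (b :: l) = L ++ e :: M := by simpa using h
      obtain ⟨A, B, hA, rfl⟩ := ih hl
      refine ⟨a :: A, B, by rw [hA, List.cons_append], ?_⟩
      cases A <;> simp_all

@[simp] lemma cost_singleton (w : V × V → ℝ≥0∞) (a : V) : cost w [a] = 0 := by simp [cost]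

@[simp] lemma cost_cons_cons (w : V × V → ℝ≥0∞) (a b : V) (l : List V) :
    cost w (a :: b :: l) = w (a, b) + cost w (b :: l) := by simp [cost]

lemma cost_append_cons (w : V × V → ℝ≥0∞) (A : List V) (x : V) (B : List V) :
    cost w (A ++ x :: B) = cost w (A ++ [x]) + cost w (x :: B) := by
  simp [cost, pathEdges_append_cons A x B]

lemma cost_mono (h : ∀ e ∈ pathEdges P, w e ≤ w' e) : cost w P ≤ cost w' P :=
  List.sum_le_sum h

lemma cost_congr (h : ∀ e ∈ pathEdges P, w e = w' e) : cost w P = cost w' P :=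
  congrArg List.sum (List.map_congr_left h)

lemma le_cost_of_mem (h : e ∈ pathEdges P) : w e ≤ cost w P :=
  List.single_le_sum (by simp) _ (List.mem_map_of_mem h)

lemma isPath_singleton (E : Finset (V × V)) (a : V) : IsPath E a a [a] := by simp [IsPath]

lemma IsPath.ne_nil (h : IsPath E a b P) : P ≠ [] := by
  rintro rfl
  simp [IsPath] at h

lemma IsPath.mem_of_mem_pathEdges (h : IsPath E a b P) (he : e ∈ pathEdges P) : e ∈ E :=
  isChain_iff_forall_mem_pathEdges.1 h.1 e he

lemma isPath_append_cons :
    IsPath E a b (A ++ x :: B) ↔ IsPath E a x (A ++ [x]) ∧ IsPath E x b (x :: B) := by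
  have hhead : (A ++ x :: B).head? = (A ++ [x]).head? := by cases A <;> simp
  unfold IsPath
  rw [List.isChain_split, hhead, List.getLast?_append_cons, List.getLast?_append_cons]
  simp only [List.head?_cons, List.getLast?_singleton, true_and, and_true]
  tauto

lemma IsPath.exists_eq_append (h : IsPath E a b P) : ∃ A, P = A ++ [b] :=
  List.getLast?_eq_some_iff.1 h.2.2

lemma IsPath.append_singleton (h : IsPath E a b P) (hbc : (b, c) ∈ E) :
    IsPath E a c (P ++ [c]) := by
  obtain ⟨A, rfl⟩ := h.exists_eq_append
  rw [List.append_assoc, List.singleton_append, isPath_append_cons]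
  exact ⟨h, by simp [IsPath, hbc]⟩

lemma IsPath.cost_append_singleton (h : IsPath E a b P) (w : V × V → ℝ≥0∞) (c : V) :
    cost w (P ++ [c]) = cost w P + w (b, c) := by
  obtain ⟨A, rfl⟩ := h.exists_eq_append
  rw [List.append_assoc, List.singleton_append, cost_append_cons]
  simp

lemma exists_eq_append_of_not_nodup (h : ¬ P.Nodup) :
    ∃ A x B C, P = A ++ x :: (B ++ x :: C) := by
  induction P with
  | nil => simp at h
  | cons a l ih =>
    by_cases ha : a ∈ l
    · obtain ⟨B, C, rfl⟩ := List.append_of_mem ha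
      exact ⟨[], a, B, C, rfl⟩
    · obtain ⟨A, x, B, C, rfl⟩ := ih fun hl ↦ h (List.nodup_cons.2 ⟨ha, hl⟩)
      exact ⟨a :: A, x, B, C, rfl⟩

lemma isPath_append_cycle :
    IsPath E a b (A ++ x :: (B ++ x :: C)) ↔
      IsPath E a b (A ++ x :: C) ∧ IsPath E x x (x :: (B ++ [x])) := by
  have hcycle : IsPath E x b (x :: (B ++ x :: C)) ↔
      IsPath E x x (x :: (B ++ [x])) ∧ IsPath E x b (x :: C) :=
    isPath_append_cons (A := x :: B)
  rw [isPath_append_cons, hcycle, isPath_append_cons (A := A) (B := C)]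
  tauto

lemma cost_append_cycle (w : V × V → ℝ≥0∞) (A : List V) (x : V) (B C : List V) :
    cost w (A ++ x :: (B ++ x :: C)) = cost w (A ++ x :: C) + cost w (x :: (B ++ [x])) := by
  have hcycle : cost w (x :: (B ++ x :: C)) = cost w (x :: (B ++ [x])) + cost w (x :: C) :=
    cost_append_cons w (x :: B) x C
  rw [cost_append_cons, hcycle, cost_append_cons w A x C]
  ring

lemma IsPath.exists_nodup (h : IsPath E a b P) :
    ∃ Q, IsPath E a b Q ∧ Q.Nodup ∧ ∀ w, cost w Q ≤ cost w P := by
  induction hn : P.length using Nat.strong_induction_on generalizing P with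
  | _ n ih =>
    by_cases hP : P.Nodup
    · exact ⟨P, h, hP, fun _ ↦ le_rfl⟩
    · obtain ⟨A, x, B, C, rfl⟩ := exists_eq_append_of_not_nodup hP
      obtain ⟨Q, hQ, hnodup, hcost⟩ := ih _ (by simp [← hn]) (isPath_append_cycle.1 h).1 rfl
      exact ⟨Q, hQ, hnodup, fun w ↦ (hcost w).trans (cost_append_cycle w A x B C ▸ le_self_add)⟩

end Paths

/-! ### Shortest paths -/

section ShortestPaths

variable {V : Type u} {I : Input V} {w w' : V × V → ℝ≥0∞} {e : V × V} {a b v x : V}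
  {P Q A B : List V}

lemma IsWeight.lazyW_le (hw : IsWeight I w) (he : e ∈ I.edges) : (I.lazyW e : ℝ≥0∞) ≤ w e := by
  rcases hw e he with h | h <;> simp [h]

lemma IsWeight.pos (hw : IsWeight I w) (he : e ∈ I.edges) : 0 < w e :=
  (ENNReal.coe_pos.2 (I.lazyW_pos e he)).trans_le (hw.lazyW_le he)

lemma IsWeight.eq_lazyW (hw : IsWeight I w) (he : e ∈ I.edges) (h : w e < ∞) : w e = I.lazyW e :=
  (hw e he).resolve_right h.ne

lemma IsWeight.cost_eq_lazy (hw : IsWeight I w) (hP : IsPath I.edges a b P) (hc : cost w P < ∞) :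
    cost w P = cost (fun e ↦ (I.lazyW e : ℝ≥0∞)) P :=
  cost_congr fun _ he ↦ hw.eq_lazyW (hP.mem_of_mem_pathEdges he) ((le_cost_of_mem he).trans_lt hc)

lemma IsWeight.cost_cycle_pos (hw : IsWeight I w) (h : IsPath I.edges x x (x :: (B ++ [x]))) :
    0 < cost w (x :: (B ++ [x])) := by
  obtain ⟨y, l, hl⟩ : ∃ y l, B ++ [x] = y :: l := by cases B <;> simp
  have he : (x, y) ∈ pathEdges (x :: (B ++ [x])) := by simp [hl]
  exact (hw.pos (h.mem_of_mem_pathEdges he)).trans_le (le_cost_of_mem he)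

lemma isShortestPath_source : IsShortestPath I w I.source [I.source] :=
  ⟨isPath_singleton _ _, by simp, by simp⟩

lemma IsShortestPath.weight_lt_top (h : IsShortestPath I w v P) (he : e ∈ pathEdges P) : w e < ∞ :=
  (le_cost_of_mem he).trans_lt h.2.1

lemma IsShortestPath.nodup (hw : IsWeight I w) (h : IsShortestPath I w v P) : P.Nodup := by
  by_contra hP
  obtain ⟨A, x, B, C, rfl⟩ := exists_eq_append_of_not_nodup hP
  obtain ⟨hpath, hcycle⟩ := isPath_append_cycle.1 h.1
  have hfin := h.2.1
  have hmin := h.2.2 _ hpath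
  rw [cost_append_cycle] at hfin hmin
  exact hmin.not_gt (ENNReal.lt_add_right (le_self_add.trans_lt hfin).ne
    (hw.cost_cycle_pos hcycle).ne')

lemma IsShortestPath.unique (hw : IsWeight I w) (hP : IsShortestPath I w v P)
    (hQ : IsShortestPath I w v Q) : P = Q := by
  refine I.no_ties v P Q hP.1 hQ.1 (hP.nodup hw) (hQ.nodup hw) ?_
  rw [← hw.cost_eq_lazy hP.1 hP.2.1, ← hw.cost_eq_lazy hQ.1 hQ.2.1]
  exact le_antisymm (hP.2.2 _ hQ.1) (hQ.2.2 _ hP.1)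

lemma IsShortestPath.initialPart (h : IsShortestPath I w v (A ++ x :: B)) :
    IsShortestPath I w x (A ++ [x]) := by
  obtain ⟨hpath, hfin, hmin⟩ := h
  obtain ⟨hA, hB⟩ := isPath_append_cons.1 hpath
  rw [cost_append_cons] at hfin
  refine ⟨hA, le_self_add.trans_lt hfin, fun Q hQ ↦ ?_⟩
  obtain ⟨Q', rfl⟩ := hQ.exists_eq_append
  have hle := hmin _ (isPath_append_cons.2 ⟨hQ, hB⟩)
  rw [cost_append_cons, cost_append_cons w Q'] at hle
  exact (ENNReal.add_le_add_iff_right (le_add_self.trans_lt hfin).ne).1 hle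

lemma exists_isShortestPath [Finite V] (hP : IsPath I.edges I.source v P) (hc : cost w P < ∞) :
    ∃ Q, IsShortestPath I w v Q := by
  cases nonempty_fintype V
  have hfin : {Q : List V | IsPath I.edges I.source v Q ∧ Q.Nodup}.Finite :=
    (List.finite_length_le V (Fintype.card V)).subset fun Q hQ ↦ hQ.2.length_le_card
  obtain ⟨P', hP', hnodup, hle⟩ := hP.exists_nodup
  obtain ⟨Q, hQ, hmin⟩ := Set.exists_min_image _ (cost w) hfin ⟨P', hP', hnodup⟩
  refine ⟨Q, hQ.1, ((hmin P' ⟨hP', hnodup⟩).trans (hle w)).trans_lt hc, fun R hR ↦ ?_⟩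
  obtain ⟨R', hR', hnodup', hle'⟩ := hR.exists_nodup
  exact (hmin R' ⟨hR', hnodup'⟩).trans (hle' w)

lemma IsShortestPath.of_le_of_eqOn (h : IsShortestPath I w v P) (hle : ∀ e ∈ I.edges, w e ≤ w' e)
    (heq : ∀ e ∈ pathEdges P, w e = w' e) : IsShortestPath I w' v P := by
  obtain ⟨hpath, hfin, hmin⟩ := h
  rw [cost_congr heq] at hfin hmin
  exact ⟨hpath, hfin, fun Q hQ ↦
    (hmin Q hQ).trans (cost_mono fun e he ↦ hle e (hQ.mem_of_mem_pathEdges he))⟩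

end ShortestPaths

/-! ### Distances and predecessors -/

section Distances

variable {V : Type u} (I : Input V) (w : V × V → ℝ≥0∞)

/-- The distance from the source to `v`, which is `∞` if there is no collision-free path. -/
noncomputable def sourceDist (v : V) : ℝ≥0∞ :=
  ⨅ (P : List V) (_ : IsPath I.edges I.source v P), cost w P

/-- `p` is the predecessor of `v` on the shortest path to `v`, that is, its parent in the complete
shortest-path tree. -/
def IsPred (p v : V) : Prop :=
  (p, v) ∈ I.edges ∧ sourceDist I w v = sourceDist I w p + w (p, v) ∧ sourceDist I w v < ∞

/-- `p` is `v` or an ancestor of `v` in the complete shortest-path tree. -/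
abbrev IsAncestor (p v : V) : Prop := Relation.ReflTransGen (IsPred I w) p v

/-- `p` is an ancestor of `v`, and not `v` itself, in the complete shortest-path tree. -/
abbrev IsProperAncestor (p v : V) : Prop := Relation.TransGen (IsPred I w) p v

variable {I w} {w' : V × V → ℝ≥0∞} {e : V × V} {p q v x : V} {P A B : List V}

lemma sourceDist_le_cost (h : IsPath I.edges I.source v P) : sourceDist I w v ≤ cost w P :=
  iInf₂_le P h

@[simp] lemma sourceDist_source : sourceDist I w I.source = 0 :=
  nonpos_iff_eq_zero.1 ((sourceDist_le_cost (isPath_singleton _ _)).trans_eq (cost_singleton _ _))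

lemma sourceDist_mono (hle : ∀ e ∈ I.edges, w e ≤ w' e) (v : V) :
    sourceDist I w v ≤ sourceDist I w' v :=
  le_iInf₂ fun _ hQ ↦
    (sourceDist_le_cost hQ).trans (cost_mono fun e he ↦ hle e (hQ.mem_of_mem_pathEdges he))

lemma IsShortestPath.cost_eq (h : IsShortestPath I w v P) : cost w P = sourceDist I w v :=
  le_antisymm (le_iInf₂ h.2.2) (sourceDist_le_cost h.1)

lemma IsShortestPath.sourceDist_lt_top (h : IsShortestPath I w v P) : sourceDist I w v < ∞ :=
  h.cost_eq ▸ h.2.1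

lemma IsPath.isShortestPath (h : IsPath I.edges I.source v P) (hle : cost w P ≤ sourceDist I w v)
    (hv : sourceDist I w v < ∞) : IsShortestPath I w v P :=
  ⟨h, hle.trans_lt hv, fun _ hQ ↦ hle.trans (sourceDist_le_cost hQ)⟩

lemma exists_isShortestPath_iff [Finite V] :
    (∃ P, IsShortestPath I w v P) ↔ sourceDist I w v < ∞ := by
  refine ⟨fun ⟨P, hP⟩ ↦ hP.sourceDist_lt_top, fun h ↦ ?_⟩
  simp only [sourceDist, iInf_lt_iff] at h
  obtain ⟨P, hP, hc⟩ := h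
  exact exists_isShortestPath hP hc

lemma sourceDist_le_add [Finite V] (h : (p, v) ∈ I.edges) :
    sourceDist I w v ≤ sourceDist I w p + w (p, v) := by
  rcases eq_or_ne (sourceDist I w p) ∞ with hp | hp
  · simp [hp]
  · obtain ⟨P, hP⟩ := exists_isShortestPath_iff.2 hp.lt_top
    rw [← hP.cost_eq, ← hP.1.cost_append_singleton]
    exact sourceDist_le_cost (hP.1.append_singleton h)

lemma IsPred.sourceDist_fst_lt_top (h : IsPred I w p v) : sourceDist I w p < ∞ :=
  (h.2.1 ▸ le_self_add : sourceDist I w p ≤ sourceDist I w v).trans_lt h.2.2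

lemma IsPred.weight_lt_top (h : IsPred I w p v) : w (p, v) < ∞ :=
  (h.2.1 ▸ le_add_self : w (p, v) ≤ sourceDist I w v).trans_lt h.2.2

lemma IsPred.sourceDist_lt (hw : IsWeight I w) (h : IsPred I w p v) :
    sourceDist I w p < sourceDist I w v :=
  h.2.1 ▸ ENNReal.lt_add_right h.sourceDist_fst_lt_top.ne (hw.pos h.1).ne'

lemma not_isPred_source (hw : IsWeight I w) (p : V) : ¬ IsPred I w p I.source := fun h ↦ by
  simpa using h.sourceDist_lt hw

lemma isPred_of_add_le [Finite V] (h : (p, v) ∈ I.edges) (hp : sourceDist I w p < ∞)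
    (hw : w (p, v) < ∞) (hle : sourceDist I w p + w (p, v) ≤ sourceDist I w v) : IsPred I w p v :=
  ⟨h, le_antisymm (sourceDist_le_add h) hle,
    (sourceDist_le_add h).trans_lt (ENNReal.add_lt_top.2 ⟨hp, hw⟩)⟩

lemma IsPred.isShortestPath_append (h : IsPred I w p v) (hP : IsShortestPath I w p P) :
    IsShortestPath I w v (P ++ [v]) :=
  (hP.1.append_singleton h.1).isShortestPath
    (by rw [hP.1.cost_append_singleton, hP.cost_eq, h.2.1]) h.2.2

lemma IsPred.unique [Finite V] (hw : IsWeight I w) (hp : IsPred I w p v) (hq : IsPred I w q v) :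
    p = q := by
  obtain ⟨P, hP⟩ := exists_isShortestPath_iff.2 hp.sourceDist_fst_lt_top
  obtain ⟨Q, hQ⟩ := exists_isShortestPath_iff.2 hq.sourceDist_fst_lt_top
  obtain rfl : P = Q :=
    List.append_cancel_right ((hp.isShortestPath_append hP).unique hw (hq.isShortestPath_append hQ))
  exact Option.some_injective _ (hP.1.2.2.symm.trans hQ.1.2.2)

lemma IsShortestPath.isPred (h : IsShortestPath I w x P) (he : e ∈ pathEdges P) :
    IsPred I w e.1 e.2 := by
  obtain ⟨L, M, hLM⟩ := List.append_of_mem he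
  obtain ⟨A, B, rfl, -⟩ := exists_append_of_pathEdges_eq hLM
  have hp : IsShortestPath I w e.1 (A ++ [e.1]) := h.initialPart
  have hv : IsShortestPath I w e.2 ((A ++ [e.1]) ++ [e.2]) :=
    IsShortestPath.initialPart (v := x) (B := B) (by simpa using h)
  refine ⟨h.1.mem_of_mem_pathEdges he, ?_, hv.sourceDist_lt_top⟩
  rw [← hv.cost_eq, ← hp.cost_eq, hp.1.cost_append_singleton]

lemma IsShortestPath.isChain_isPred (h : IsShortestPath I w v P) : P.IsChain (IsPred I w) :=
  isChain_iff_forall_mem_pathEdges.2 fun _ he ↦ h.isPred he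

lemma IsShortestPath.eq_singleton_or_exists (h : IsShortestPath I w v P) :
    (v = I.source ∧ P = [I.source]) ∨
      ∃ p Q, IsPred I w p v ∧ IsShortestPath I w p Q ∧ P = Q ++ [v] := by
  obtain ⟨A, rfl⟩ := h.1.exists_eq_append
  rcases List.eq_nil_or_concat A with rfl | ⟨Q, p, rfl⟩
  · obtain rfl : v = I.source := by simpa [IsPath] using h.1.2.1
    exact Or.inl ⟨rfl, rfl⟩
  · simp only [List.concat_eq_append, List.append_assoc, List.singleton_append] at h
    exact Or.inr ⟨p, Q ++ [p], h.isPred (e := (p, v)) (by rw [pathEdges_append_cons]; simp),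
      h.initialPart, by simp⟩

lemma IsShortestPath.isAncestor (h : IsShortestPath I w v P) (hx : x ∈ P) : IsAncestor I w x v := by
  obtain ⟨A, B, rfl⟩ := List.append_of_mem hx
  refine List.relationReflTransGen_of_exists_isChain_cons B
    (List.isChain_split.1 h.isChain_isPred).2 (Option.some_injective _ ?_)
  rw [← List.getLast?_eq_some_getLast, ← h.1.2.2, List.getLast?_append_cons]

lemma exists_isPred [Finite V] (hv : sourceDist I w v < ∞) (hs : v ≠ I.source) :
    ∃ p, IsPred I w p v := by
  obtain ⟨P, hP⟩ := exists_isShortestPath_iff.2 hv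
  obtain ⟨p, -, hp, -⟩ := hP.eq_singleton_or_exists.resolve_left fun h ↦ hs h.1
  exact ⟨p, hp⟩

lemma sourceDist_induction [Finite V] {motive : V → Prop} (source : motive I.source)
    (step : ∀ p v, IsPred I w p v → motive p → motive v) (hv : sourceDist I w v < ∞) :
    motive v := by
  obtain ⟨P, hP⟩ := exists_isShortestPath_iff.2 hv
  induction hn : P.length generalizing v P with
  | zero => exact absurd (List.length_eq_zero_iff.1 hn) hP.1.ne_nil
  | succ n ih =>
    rcases hP.eq_singleton_or_exists with ⟨rfl, -⟩ | ⟨p, Q, hp, hQ, rfl⟩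
    · exact source
    · exact step p v hp (ih hp.sourceDist_fst_lt_top Q hQ (by simpa using hn))

lemma sourceDist_eq_of_le [Finite V] (hle : ∀ e ∈ I.edges, w e ≤ w' e)
    (heq : ∀ p y, IsPred I w p y → IsAncestor I w y x → w' (p, y) = w (p, y))
    (hx : sourceDist I w x < ∞) : sourceDist I w' x = sourceDist I w x := by
  refine le_antisymm ?_ (sourceDist_mono hle x)
  revert heq
  refine sourceDist_induction (motive := fun x ↦
    (∀ p y, IsPred I w p y → IsAncestor I w y x → w' (p, y) = w (p, y)) →
      sourceDist I w' x ≤ sourceDist I w x) (by simp) (fun p v hpv ih heq ↦ ?_) hx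
  rw [hpv.2.1, ← heq p v hpv .refl]
  exact (sourceDist_le_add hpv.1).trans
    (add_le_add_left (ih fun q y hq hy ↦ heq q y hq (hy.tail hpv)) _)

lemma isPred_iff_of_le [Finite V] (hw' : IsWeight I w') (hle : ∀ e ∈ I.edges, w e ≤ w' e)
    (heq : ∀ p y, IsPred I w p y → IsAncestor I w y x → w' (p, y) = w (p, y))
    (hx : sourceDist I w x < ∞) : IsPred I w' p x ↔ IsPred I w p x := by
  have hpred : ∀ q, IsPred I w q x → IsPred I w' q x := fun q hq ↦ by
    have hdist := sourceDist_eq_of_le hle heq hx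
    refine ⟨hq.1, ?_, hdist ▸ hx⟩
    rw [hdist, hq.2.1, heq q x hq .refl, sourceDist_eq_of_le hle
      (fun p y hp hy ↦ heq p y hp (hy.tail hq)) hq.sourceDist_fst_lt_top]
  refine ⟨fun h ↦ ?_, hpred p⟩
  obtain ⟨q, hq⟩ := exists_isPred hx fun hs ↦ not_isPred_source hw' p (hs ▸ h)
  rwa [h.unique hw' (hpred q hq)]

lemma IsAncestor.sourceDist_le (h : IsAncestor I w p v) : sourceDist I w p ≤ sourceDist I w v := by
  induction h with
  | refl => exact le_rfl
  | tail _ h ih => exact ih.trans (h.2.1 ▸ le_self_add)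

lemma IsProperAncestor.sourceDist_lt (hw : IsWeight I w) (h : IsProperAncestor I w p v) :
    sourceDist I w p < sourceDist I w v := by
  induction h with
  | single h => exact h.sourceDist_lt hw
  | tail _ h ih => exact ih.trans (h.sourceDist_lt hw)

lemma exists_first_ancestor_notMem [Finite V] (hw : IsWeight I w) {S : Set V} (hv : v ∉ S) :
    ∃ y, y ∉ S ∧ IsAncestor I w y v ∧ ∀ x, IsProperAncestor I w x y → x ∈ S := by
  obtain ⟨y, ⟨hy, hyv⟩, hmin⟩ := Set.exists_min_image {y | y ∉ S ∧ IsAncestor I w y v}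
    (sourceDist I w) (Set.toFinite _) ⟨v, hv, .refl⟩
  refine ⟨y, hy, hyv, fun x hx ↦ ?_⟩
  by_contra hxS
  exact (hmin x ⟨hxS, hx.to_reflTransGen.trans hyv⟩).not_gt (IsProperAncestor.sourceDist_lt hw hx)

/-- The first ancestor of `p` outside the settled set `S` is in the queue `Q`, and its key is its
distance; as the key of `p` is minimal, `p` cannot lie strictly behind it. -/
lemma dijkstra_key_eq [Finite V] (hw : IsWeight I w) {S Q : Set V} {key : V → ℝ≥0∞}
    (hsource : I.source ∉ S → I.source ∈ Q ∧ key I.source ≤ 0)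
    (hsucc : ∀ x ∈ S, ∀ y ∉ S, IsPred I w x y → y ∈ Q ∧ key y ≤ sourceDist I w y)
    (hle : sourceDist I w p ≤ key p) (hmin : ∀ q ∈ Q, key p ≤ key q) (hpS : p ∉ S)
    (hp : sourceDist I w p < ∞) :
    key p = sourceDist I w p ∧ ∀ q, IsProperAncestor I w q p → q ∈ S := by
  obtain ⟨y, hyS, hyp, hanc⟩ := exists_first_ancestor_notMem hw hpS
  have hkey : key p ≤ sourceDist I w y := by
    rcases eq_or_ne y I.source with rfl | hy
    · obtain ⟨hQ, h0⟩ := hsource hyS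
      exact (hmin _ hQ).trans (by simpa using h0)
    · obtain ⟨x, hx⟩ := exists_isPred (hyp.sourceDist_le.trans_lt hp) hy
      obtain ⟨hQ, hd⟩ := hsucc x (hanc x (.single hx)) y hyS hx
      exact (hmin _ hQ).trans hd
  rcases Relation.reflTransGen_iff_eq_or_transGen.1 hyp with rfl | hyp
  · exact ⟨le_antisymm hkey hle, hanc⟩
  · exact absurd (hle.trans hkey) (IsProperAncestor.sourceDist_lt hw hyp).not_ge

end Distances

/-! ### Executions of algorithms -/

namespace Algorithm

variable {V : Type u} {A : Algorithm V} {I : Input V} {w w' : V × V → ℝ≥0∞}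

lemma stateAt_succ_of_eval {n : ℕ} {e : V × V} (h : A.action I (A.stateAt I w n) = .eval e) :
    A.stateAt I w (n + 1) = A.next I (A.stateAt I w n) (w e) := by
  rw [stateAt, Function.iterate_succ_apply', ← stateAt, step, h]

lemma stateAt_succ_of_report {n : ℕ} {r : Option (List V)}
    (h : A.action I (A.stateAt I w n) = .report r) :
    A.stateAt I w (n + 1) = A.stateAt I w n := by
  rw [stateAt, Function.iterate_succ_apply', ← stateAt, step, h]

lemma stateAt_congr (h : ∀ e ∈ A.testedEdges I w, w e = w' e) (n : ℕ) :
    A.stateAt I w n = A.stateAt I w' n := by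
  induction n with
  | zero => rfl
  | succ n ih =>
    cases hact : A.action I (A.stateAt I w n) with
    | eval e =>
      rw [stateAt_succ_of_eval hact, stateAt_succ_of_eval (ih ▸ hact), h e ⟨n, hact⟩, ih]
    | report r => rw [stateAt_succ_of_report hact, stateAt_succ_of_report (ih ▸ hact), ih]

lemma encard_testedEdges_le : (A.testedEdges I w).encard ≤ (A.evalTimes I w).encard := by
  have : Nonempty (V × V) := ⟨(I.source, I.source)⟩
  have hex : ∀ n ∈ A.evalTimes I w, ∃ e, A.action I (A.stateAt I w n) = .eval e := fun _ h ↦ h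
  choose! f hf using hex
  have hsub : A.testedEdges I w ⊆ f '' A.evalTimes I w := by
    rintro e ⟨n, hn⟩
    exact ⟨n, ⟨e, hn⟩, Action.eval.inj ((hf n ⟨e, hn⟩).symm.trans hn)⟩
  exact (Set.encard_le_encard hsub).trans (Set.encard_image_le _ _)

lemma encard_evalTimes_le
    (hinj : ∀ m n e, A.action I (A.stateAt I w m) = .eval e →
      A.action I (A.stateAt I w n) = .eval e → m = n) :
    (A.evalTimes I w).encard ≤ (A.testedEdges I w).encard := by
  have : Nonempty (V × V) := ⟨(I.source, I.source)⟩
  have hex : ∀ n ∈ A.evalTimes I w, ∃ e, A.action I (A.stateAt I w n) = .eval e := fun _ h ↦ h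
  choose! f hf using hex
  exact Set.encard_le_encard_of_injOn (fun n hn ↦ ⟨n, hf n hn⟩)
    fun m hm n hn h ↦ hinj m n (f n) (h ▸ hf m hm) (hf n hn)

lemma exists_report (hfin : (A.evalTimes I w).Finite) :
    ∃ n r, A.action I (A.stateAt I w n) = .report r := by
  obtain ⟨n, hn⟩ := hfin.exists_notMem
  cases h : A.action I (A.stateAt I w n) with
  | eval e => exact absurd ⟨e, h⟩ hn
  | report r => exact ⟨n, r, h⟩

end Algorithm

/-! ### The edges that every algorithm of the family has to test -/

section LowerBound

variable {V : Type u} {I : Input V} {w w₁ w₂ ω : V × V → ℝ≥0∞} {e : V × V} {v : V} {P : List V}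
  {B : Algorithm V} {T : Tree V}

lemma eq_of_isChain_parent {π : V → Option V} : ∀ {P Q : List V},
    P.IsChain (fun a b ↦ π a = some b) → Q.IsChain (fun a b ↦ π a = some b) →
    P.head? = Q.head? → P.getLast?.bind π = none → Q.getLast?.bind π = none → P = Q
  | [], [], _, _, _, _, _ => rfl
  | [], _ :: _, _, _, h, _, _ => by simp at h
  | _ :: _, [], _, _, h, _, _ => by simp at h
  | [a], [b], _, _, h, _, _ => by simpa using h
  | [a], b :: b' :: Q, _, hQ, h, ha, _ => by simp_all
  | a :: a' :: P, [b], hP, _, h, _, hb => by simp_all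
  | a :: a' :: P, b :: b' :: Q, hP, hQ, h, ha, hb => by
    obtain rfl : a = b := by simpa using h
    rw [List.isChain_cons_cons] at hP hQ
    obtain rfl : a' = b' := Option.some_injective _ (hP.1.symm.trans hQ.1)
    rw [eq_of_isChain_parent hP.2 hQ.2 rfl (by simpa using ha) (by simpa using hb)]

lemma IsShortestPathTree.isShortestPath (h₁ : IsShortestPathTree I w₁ T)
    (h₂ : IsShortestPathTree I w₂ T) (hw₁ : IsWeight I w₁) (hv : v ∈ T.verts)
    (hP : IsShortestPath I w₁ v P) : IsShortestPath I w₂ v P := by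
  obtain ⟨P₁, hP₁, -, hc₁⟩ := h₁.2.2 v hv
  obtain ⟨P₂, hP₂, -, hc₂⟩ := h₂.2.2 v hv
  have heq : P₁.reverse = P₂.reverse :=
    eq_of_isChain_parent (List.isChain_reverse.2 hc₁) (List.isChain_reverse.2 hc₂)
      (by simp [hP₁.1.2.2, hP₂.1.2.2]) (by simp [hP₁.1.2.1, h₁.2.1])
      (by simp [hP₂.1.2.1, h₁.2.1])
  rwa [hP.unique hw₁ hP₁, List.reverse_injective heq]

/-- An algorithm that cannot tell `w₁` from `w₂` commits to the same shortest paths for both: to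
the target, which it reports, and to the initial vertices of the edges that it tests. -/
lemma InSP.isShortestPath (hB : InSP B) (hw₁ : IsWeight I w₁) (hw₂ : IsWeight I w₂)
    (h₁ : ∀ e ∈ B.testedEdges I w, w e = w₁ e) (h₂ : ∀ e ∈ B.testedEdges I w, w e = w₂ e)
    (hv : v = I.target ∨ ∃ e ∈ B.testedEdges I w, e.1 = v) (hP : IsShortestPath I w₁ v P) :
    IsShortestPath I w₂ v P := by
  obtain ⟨T, hT⟩ := hB
  have heq (n : ℕ) : B.stateAt I w₁ n = B.stateAt I w₂ n :=
    (Algorithm.stateAt_congr h₁ n).symm.trans (Algorithm.stateAt_congr h₂ n)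
  obtain ⟨htree₁, heval₁, ⟨n, r, hr⟩, hsome₁, hnone₁⟩ := hT I w₁ hw₁
  obtain ⟨htree₂, -, -, hsome₂, -⟩ := hT I w₂ hw₂
  rcases hv with rfl | ⟨e, ⟨n, hn⟩, rfl⟩
  · cases r with
    | none => exact absurd ⟨P, hP⟩ (hnone₁ n hr)
    | some Q =>
      rw [hP.unique hw₁ (hsome₁ n Q hr)]
      exact hsome₂ n Q (heq n ▸ hr)
  · rw [Algorithm.stateAt_congr h₁] at hn
    exact (htree₁ n).isShortestPath (heq n ▸ htree₂ n) hw₁ (heval₁ n e hn).2 hP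

lemma IsWeight.update_top [DecidableEq V] (hw : IsWeight I w) (e : V × V) :
    IsWeight I (Function.update w e ∞) := by
  intro f hf
  rcases eq_or_ne f e with rfl | h
  · simp
  · simpa [h] using hw f hf

open Classical in
/-- The weights in which the edges of `P` are made collision-free. They are the answers of the
adversary in the lower bound. -/
noncomputable def freeAlong (I : Input V) (w : V × V → ℝ≥0∞) (P : List V) (e : V × V) : ℝ≥0∞ :=
  if e ∈ pathEdges P then I.lazyW e else w e

lemma freeAlong_of_mem (h : e ∈ pathEdges P) : freeAlong I w P e = I.lazyW e := if_pos h

lemma freeAlong_of_notMem (h : e ∉ pathEdges P) : freeAlong I w P e = w e := if_neg h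

lemma IsWeight.freeAlong (hw : IsWeight I w) (P : List V) :
    IsWeight I (freeAlong I w P) := fun e he ↦ by
  by_cases h : e ∈ pathEdges P
  · exact Or.inl (freeAlong_of_mem h)
  · rw [freeAlong_of_notMem h]
    exact hw e he

lemma IsShortestPath.freeAlong (hω : IsWeight I ω) (hle : ∀ e ∈ I.edges, ω e ≤ w e)
    (h : IsShortestPath I ω v P) : IsShortestPath I (freeAlong I w P) v P := by
  have hlazy : ∀ e ∈ pathEdges P, ω e = LazySearch.freeAlong I w P e := fun e he ↦
    (hω.eq_lazyW (h.1.mem_of_mem_pathEdges he) (h.weight_lt_top he)).trans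
      (freeAlong_of_mem he).symm
  refine h.of_le_of_eqOn (fun e he ↦ ?_) hlazy
  by_cases heP : e ∈ pathEdges P
  · exact (hlazy e heP).le
  · exact (hle e he).trans_eq (freeAlong_of_notMem heP).symm

/-- If the algorithm sees no collision on `P`, then all edges of `P` might be collision-free, so
the algorithm has to make sure that `e` is. -/
lemma InSP.exists_tested_collision (hB : InSP B) (hw : IsWeight I w) (hω : IsWeight I ω)
    (hle : ∀ e ∈ I.edges, ω e ≤ w e) (hP : IsShortestPath I ω v P)
    (hv : v = I.target ∨ ∃ e ∈ B.testedEdges I w, e.1 = v) (heP : e ∈ pathEdges P)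
    (he : e ∉ B.testedEdges I w) :
    ∃ f ∈ pathEdges P, f ∈ B.testedEdges I w ∧ w f = ∞ := by
  classical
  by_contra! hfree
  have hagree₁ : ∀ f ∈ B.testedEdges I w, w f = freeAlong I w P f := fun f hf ↦ by
    by_cases hfP : f ∈ pathEdges P
    · rw [freeAlong_of_mem hfP]
      exact hw.eq_lazyW (hP.1.mem_of_mem_pathEdges hfP) (hfree f hfP hf).lt_top
    · rw [freeAlong_of_notMem hfP]
  have hagree₂ : ∀ f ∈ B.testedEdges I w, w f = Function.update w e ∞ f := fun f hf ↦
    (Function.update_of_ne (ne_of_mem_of_not_mem hf he) _ _).symm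
  have hPe := hB.isShortestPath (hw.freeAlong P) (hw.update_top e) hagree₁ hagree₂ hv
    (hP.freeAlong hω hle)
  simpa using hPe.weight_lt_top heP

/-- Before any algorithm of the family can commit to a path through the untested edge `e`, it has
to find a collision on it. The first collision that it finds on `P` lies behind `e`, and it has
committed to the part of `P` that precedes this collision. -/
lemma InSP.mem_testedEdges (hB : InSP B) (hw : IsWeight I w) (hω : IsWeight I ω)
    (hle : ∀ e ∈ I.edges, ω e ≤ w e) (hP : IsShortestPath I ω I.target P) {L M : List (V × V)}
    (hsplit : pathEdges P = L ++ e :: M) (hL : ∀ f ∈ L, w f < ∞) :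
    e ∈ B.testedEdges I w := by
  classical
  by_contra he
  have hLe : ∀ f ∈ L ++ [e], ¬ (f ∈ B.testedEdges I w ∧ w f = ∞) := by
    rintro f hf ⟨hftest, hftop⟩
    rcases List.mem_append.1 hf with hf | hf
    · exact (hL f hf).ne hftop
    · exact he (List.mem_singleton.1 hf ▸ hftest)
  obtain ⟨g, hgP, hg⟩ := hB.exists_tested_collision hw hω hle hP (.inl rfl) (by simp [hsplit]) he
  have hgM : g ∈ M := by
    rw [hsplit, List.append_cons] at hgP
    exact (List.mem_append.1 hgP).resolve_left fun h ↦ hLe g h hg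
  obtain ⟨f, hfind⟩ := Option.isSome_iff_exists.1
    (List.find?_isSome (p := fun f ↦ f ∈ B.testedEdges I w ∧ w f = ∞).2 ⟨g, hgM, by simpa using hg⟩)
  obtain ⟨hf, M₁, M₂, rfl, hM₁⟩ := List.find?_eq_some_iff_append.1 hfind
  obtain ⟨R, S, rfl, hR⟩ := exists_append_of_pathEdges_eq (e := f) (L := L ++ e :: M₁) (M := M₂)
    (hsplit.trans (by simp))
  obtain ⟨g, hgR, hg⟩ := hB.exists_tested_collision hw hω hle hP.initialPart
    (.inr ⟨f, by simpa using (of_decide_eq_true hf).1, rfl⟩) (by simp [hR]) he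
  rw [hR, List.append_cons] at hgR
  rcases List.mem_append.1 hgR with hgL | hgM₁
  · exact hLe g hgL hg
  · simpa [hg] using hM₁ g hgM₁

end LowerBound

/-! ### LazySP -/

section LazySP

variable {V : Type u} {I : Input V} {w : V × V → ℝ≥0∞} {known : V × V → Option ℝ≥0∞}
  {e : V × V} {v : V} {P : List V}

/-- The recorded values are true weights of edges of the graph: the invariant of LazySP. -/
def Agrees (I : Input V) (w : V × V → ℝ≥0∞) (known : V × V → Option ℝ≥0∞) : Prop :=
  ∀ e y, known e = some y → e ∈ I.edges ∧ y = w e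

lemma currentWeight_of_eq_none (h : known e = none) : currentWeight I known e = I.lazyW e := by
  simp [currentWeight, h]

lemma agrees_none : Agrees I w fun _ ↦ none := by simp [Agrees]

lemma Agrees.currentWeight_of_ne_none (h : Agrees I w known) (he : known e ≠ none) :
    currentWeight I known e = w e := by
  obtain ⟨y, hy⟩ := Option.ne_none_iff_exists'.1 he
  simp [currentWeight, hy, (h e y hy).2]

lemma Agrees.isWeight (h : Agrees I w known) (hw : IsWeight I w) :
    IsWeight I (currentWeight I known) := fun e he ↦ by
  by_cases hk : known e = none
  · exact .inl (currentWeight_of_eq_none hk)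
  · exact h.currentWeight_of_ne_none hk ▸ hw e he

lemma Agrees.currentWeight_le (h : Agrees I w known) (hw : IsWeight I w) (he : e ∈ I.edges) :
    currentWeight I known e ≤ w e := by
  by_cases hk : known e = none
  · exact currentWeight_of_eq_none (I := I) hk ▸ hw.lazyW_le he
  · exact (h.currentWeight_of_ne_none hk).le

lemma Agrees.isShortestPath (h : Agrees I w known) (hw : IsWeight I w)
    (hP : IsShortestPath I (currentWeight I known) v P) (hk : ∀ e ∈ pathEdges P, known e ≠ none) :
    IsShortestPath I w v P :=
  hP.of_le_of_eqOn (fun _ he ↦ h.currentWeight_le hw he)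
    fun e he ↦ h.currentWeight_of_ne_none (hk e he)

lemma Agrees.not_exists_isShortestPath [Finite V] (h : Agrees I w known) (hw : IsWeight I w)
    (hv : ¬ ∃ P, IsShortestPath I (currentWeight I known) v P) :
    ¬ ∃ P, IsShortestPath I w v P := by
  rw [exists_isShortestPath_iff] at hv ⊢
  exact fun hlt ↦ hv ((sourceDist_mono (fun e he ↦ h.currentWeight_le hw he) v).trans_lt hlt)

lemma Agrees.update [DecidableEq V] (h : Agrees I w known) (he : e ∈ I.edges) :
    Agrees I w (Function.update known e (some (w e))) := by
  intro f y hf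
  rcases eq_or_ne f e with rfl | hfe
  · exact ⟨he, by simpa using hf.symm⟩
  · exact h f y (Function.update_of_ne hfe (some (w e)) known ▸ hf)

lemma lazySPAction_of_isShortestPath (hk : IsWeight I (currentWeight I known))
    (hP : IsShortestPath I (currentWeight I known) I.target P) :
    lazySPAction I known =
      ((pathEdges P).find? fun e ↦ (known e).isNone).elim (.report (some P)) .eval := by
  have hex : ∃ P, IsShortestPath I (currentWeight I known) I.target P := ⟨P, hP⟩
  rw [lazySPAction, dif_pos hex]
  simp only [hex.choose_spec.unique hk hP]
  cases (pathEdges P).find? fun e ↦ (known e).isNone <;> rfl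

lemma lazySPAction_of_not_exists
    (h : ¬ ∃ P, IsShortestPath I (currentWeight I known) I.target P) :
    lazySPAction I known = .report none :=
  dif_neg h

lemma exists_isShortestPath_of_lazySPAction_eq_eval (h : lazySPAction I known = .eval e) :
    ∃ P, IsShortestPath I (currentWeight I known) I.target P ∧
      (pathEdges P).find? (fun e ↦ (known e).isNone) = some e := by
  unfold lazySPAction at h
  split at h
  · next hex =>
    refine ⟨hex.choose, hex.choose_spec, ?_⟩
    split at h <;> simp_all
  · simp at h

lemma isShortestPath_of_lazySPAction_eq_report_some
    (h : lazySPAction I known = .report (some P)) :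
    IsShortestPath I (currentWeight I known) I.target P ∧ ∀ e ∈ pathEdges P, known e ≠ none := by
  unfold lazySPAction at h
  split at h
  · next hex =>
    split at h
    · simp at h
    · next hfind =>
      obtain rfl : hex.choose = P := by simpa using h
      exact ⟨hex.choose_spec, fun e he ↦ by simpa using List.find?_eq_none.1 hfind e he⟩
  · simp at h

lemma not_exists_isShortestPath_of_lazySPAction_eq_report_none
    (h : lazySPAction I known = .report none) :
    ¬ ∃ P, IsShortestPath I (currentWeight I known) I.target P := by
  unfold lazySPAction at h
  split at h
  · split at h <;> simp at h
  · assumption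

lemma mem_edges_and_eq_none_of_lazySPAction_eq_eval (h : lazySPAction I known = .eval e) :
    e ∈ I.edges ∧ known e = none := by
  obtain ⟨P, hP, hfind⟩ := exists_isShortestPath_of_lazySPAction_eq_eval h
  exact ⟨hP.1.mem_of_mem_pathEdges (List.mem_of_find?_eq_some hfind),
    by simpa using List.find?_some hfind⟩

open Classical in
/-- The tree that LazySP builds: the vertices to which all edges of the shortest path for the
current weights have been evaluated. -/
noncomputable def lazySPTree (I : Input V) (known : V × V → Option ℝ≥0∞) : Tree V where
  verts := {v | ∃ P, IsShortestPath I (currentWeight I known) v P ∧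
    ∀ e ∈ pathEdges P, known e ≠ none}
  parent v := if h : ∃ p, IsPred I (currentWeight I known) p v then some h.choose else none

lemma isShortestPathTree_lazySPTree [Finite V] (h : Agrees I w known) (hw : IsWeight I w) :
    IsShortestPathTree I w (lazySPTree I known) := by
  have hk := h.isWeight hw
  refine ⟨⟨[I.source], isShortestPath_source, by simp⟩,
    dif_neg fun ⟨p, hp⟩ ↦ not_isPred_source hk p hp, ?_⟩
  rintro v ⟨P, hP, heval⟩
  refine ⟨P, h.isShortestPath hw hP heval, fun x hx ↦ ?_, hP.isChain_isPred.imp fun a b hab ↦ ?_⟩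
  · obtain ⟨A, B, rfl⟩ := List.append_of_mem hx
    refine ⟨A ++ [x], hP.initialPart, fun e he ↦ heval e ?_⟩
    rw [pathEdges_append_cons]
    exact List.mem_append_left _ he
  · have hex : ∃ p, IsPred I (currentWeight I known) p b := ⟨a, hab⟩
    exact (dif_pos hex).trans (congrArg some (hex.choose_spec.unique hk hab))

variable [DecidableEq V]

/-- The values that LazySP has recorded after `n` steps. -/
noncomputable abbrev lazySPKnown (I : Input V) (w : V × V → ℝ≥0∞) (n : ℕ) :
    V × V → Option ℝ≥0∞ :=
  (lazySP V).stateAt I w n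

lemma lazySP_next_of_eval (h : lazySPAction I known = .eval e) (x : ℝ≥0∞) :
    (lazySP V).next I known x = Function.update known e (some x) := by
  simp only [lazySP, h]

lemma lazySPKnown_succ_of_eval {n : ℕ} (h : lazySPAction I (lazySPKnown I w n) = .eval e) :
    lazySPKnown I w (n + 1) = Function.update (lazySPKnown I w n) e (some (w e)) := by
  rw [lazySPKnown, Algorithm.stateAt_succ_of_eval h, lazySP_next_of_eval h]

lemma lazySPKnown_succ_of_report {n : ℕ} {r : Option (List V)}
    (h : lazySPAction I (lazySPKnown I w n) = .report r) :
    lazySPKnown I w (n + 1) = lazySPKnown I w n :=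
  Algorithm.stateAt_succ_of_report h

lemma agrees_lazySPKnown (n : ℕ) : Agrees I w (lazySPKnown I w n) := by
  induction n with
  | zero => exact agrees_none
  | succ n ih =>
    cases h : lazySPAction I (lazySPKnown I w n) with
    | eval e =>
      rw [lazySPKnown_succ_of_eval h]
      exact ih.update (mem_edges_and_eq_none_of_lazySPAction_eq_eval h).1
    | report r => rwa [lazySPKnown_succ_of_report h]

lemma lazySPKnown_ne_none_of_le {m n : ℕ} (hmn : m ≤ n) (he : lazySPKnown I w m e ≠ none) :
    lazySPKnown I w n e ≠ none := by
  induction n, hmn using Nat.le_induction with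
  | base => exact he
  | succ n _ ih =>
    cases h : lazySPAction I (lazySPKnown I w n) with
    | eval f =>
      rw [lazySPKnown_succ_of_eval h]
      rcases eq_or_ne e f with rfl | hf
      · simp
      · rwa [Function.update_of_ne hf]
    | report r => rwa [lazySPKnown_succ_of_report h]

lemma lazySP_eval_unique (m n : ℕ) (e : V × V)
    (hm : (lazySP V).action I (lazySPKnown I w m) = .eval e)
    (hn : (lazySP V).action I (lazySPKnown I w n) = .eval e) : m = n := by
  wlog hmn : m ≤ n generalizing m n
  · exact (this n m hn hm (le_of_not_ge hmn)).symm
  refine hmn.eq_of_not_lt fun hlt ↦ ?_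
  refine lazySPKnown_ne_none_of_le (I := I) (w := w) (e := e) hlt ?_
    (mem_edges_and_eq_none_of_lazySPAction_eq_eval hn).2
  rw [lazySPKnown_succ_of_eval hm]
  simp

lemma lazySP_evalTimes_finite : ((lazySP V).evalTimes I w).Finite := by
  have hsub : (lazySP V).testedEdges I w ⊆ I.edges := fun e ⟨_, he⟩ ↦
    (mem_edges_and_eq_none_of_lazySPAction_eq_eval he).1
  exact Set.encard_lt_top_iff.1 ((Algorithm.encard_evalTimes_le lazySP_eval_unique).trans_lt
    (I.edges.finite_toSet.subset hsub).encard_lt_top)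

theorem inSP_lazySP [Finite V] : InSP (lazySP V) := by
  refine ⟨lazySPTree, fun I w hw ↦
    ⟨fun n ↦ isShortestPathTree_lazySPTree (agrees_lazySPKnown n) hw, fun n e he ↦ ?_,
      Algorithm.exists_report lazySP_evalTimes_finite, fun n P h ↦ ?_, fun n h ↦ ?_⟩⟩
  · refine ⟨(mem_edges_and_eq_none_of_lazySPAction_eq_eval he).1, ?_⟩
    obtain ⟨P, hP, hfind⟩ := exists_isShortestPath_of_lazySPAction_eq_eval he
    obtain ⟨-, L, M, hsplit, hL⟩ := List.find?_eq_some_iff_append.1 hfind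
    obtain ⟨A, B, rfl, rfl⟩ := exists_append_of_pathEdges_eq hsplit
    exact ⟨A ++ [e.1], hP.initialPart,
      fun f hf ↦ Option.isSome_iff_ne_none.1 (by simpa using hL f hf)⟩
  · obtain ⟨hP, heval⟩ := isShortestPath_of_lazySPAction_eq_report_some h
    exact (agrees_lazySPKnown n).isShortestPath hw hP heval
  · exact (agrees_lazySPKnown n).not_exists_isShortestPath hw
      (not_exists_isShortestPath_of_lazySPAction_eq_report_none h)

lemma InSP.lazySP_testedEdges_subset {B : Algorithm V} (hB : InSP B) (hw : IsWeight I w) :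
    (lazySP V).testedEdges I w ⊆ B.testedEdges I w := by
  rintro e ⟨n, hn⟩
  have hagree : Agrees I w (lazySPKnown I w n) := agrees_lazySPKnown n
  obtain ⟨P, hP, hfind⟩ := exists_isShortestPath_of_lazySPAction_eq_eval hn
  obtain ⟨-, L, M, hsplit, hL⟩ := List.find?_eq_some_iff_append.1 hfind
  refine hB.mem_testedEdges hw (hagree.isWeight hw) (fun e he ↦ hagree.currentWeight_le hw he) hP
    hsplit fun f hf ↦ ?_
  rw [← hagree.currentWeight_of_ne_none (Option.isSome_iff_ne_none.1 (by simpa using hL f hf))]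
  exact hP.weight_lt_top (by simp [hsplit, hf])

lemma edgeOptimal_of_action_eq {A : Algorithm V} (hA : InSP A)
    (h : ∀ (I : Input V) (w : V × V → ℝ≥0∞), IsWeight I w → ∀ n,
      A.action I (A.stateAt I w n) = lazySPAction I (lazySPKnown I w n)) : EdgeOptimal A := by
  refine ⟨hA, fun B hB I w hw ↦ ?_⟩
  have htested : A.testedEdges I w = (lazySP V).testedEdges I w := by
    simp only [Algorithm.testedEdges, h I w hw]
    rfl
  have htimes : A.evalTimes I w = (lazySP V).evalTimes I w := by
    simp only [Algorithm.evalTimes, h I w hw]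
    rfl
  have hle := Set.encard_le_encard (hB.lazySP_testedEdges_subset hw)
  rw [htested, htimes]
  exact ⟨hle, (Algorithm.encard_evalTimes_le lazySP_eval_unique).trans
    (hle.trans Algorithm.encard_testedEdges_le)⟩

theorem edgeOptimal_lazySP [Finite V] : EdgeOptimal (lazySP V) :=
  edgeOptimal_of_action_eq inSP_lazySP fun _ _ _ _ ↦ rfl

end LazySP

/-! ### The search tree of LRA* -/

section Loops

variable {σ : Type u} {cond : σ → Prop} {body : σ → σ} {s : σ}

lemma whileLoop_of_not (h : ¬ cond s) : whileLoop cond body s = s := by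
  classical
  have hex : ∃ n, ¬ cond (body^[n] s) := ⟨0, h⟩
  rw [whileLoop, dif_pos hex, (Nat.find_eq_zero hex).2 h, Function.iterate_zero_apply]

lemma whileLoop_induction (Inv : σ → Prop) (μ : σ → ℕ)
    (h : ∀ s, Inv s → cond s → Inv (body s) ∧ μ (body s) < μ s) (hs : Inv s) :
    Inv (whileLoop cond body s) ∧ ¬ cond (whileLoop cond body s) := by
  classical
  have hex : ∃ n, ¬ cond (body^[n] s) := by
    induction hm : μ s using Nat.strong_induction_on generalizing s with
    | _ m ih =>
      by_cases hc : cond s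
      · obtain ⟨hbody, hμ⟩ := h s hs hc
        obtain ⟨n, hn⟩ := ih _ (hm ▸ hμ) hbody rfl
        exact ⟨n + 1, hn⟩
      · exact ⟨0, hc⟩
  have hinv : ∀ n ≤ Nat.find hex, Inv (body^[n] s) := by
    intro n
    induction n with
    | zero => exact fun _ ↦ hs
    | succ n ih =>
      intro hn
      rw [Function.iterate_succ_apply']
      exact (h _ (ih (by lia)) (not_not.1 (Nat.find_min hex (by lia)))).1
  rw [whileLoop, dif_pos hex]
  exact ⟨hinv _ le_rfl, Nat.find_spec hex⟩

lemma foldl_induction {τ β : Type*} (f : τ → β → τ) (Inv : List β → τ → Prop)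
    (h : ∀ b L s, Inv (b :: L) s → Inv L (f s b)) :
    ∀ (L : List β) (s : τ), Inv L s → Inv [] (L.foldl f s)
  | [], _, hs => hs
  | b :: L, s, hs => foldl_induction f Inv h L (f s b) (h b L s hs)

lemma singleton_prod_mem_cons {β γ : Type*} (b : β) (c : γ) (L : List γ) :
    ({b} ×ˢ {x | x ∈ c :: L} : Set (β × γ)) = insert (b, c) ({b} ×ˢ {x | x ∈ L}) := by
  rw [List.setOfPred_mem_cons, Set.prod_insert, Set.image_singleton, Set.singleton_union]

end Loops

section Entries

variable {V : Type u} (I : Input V) (w : V × V → ℝ≥0∞) (Ev : Set V)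

/-- The entry `t` of `v` describes the shortest path to `v` for the weights `w`. The vertices to
which this path is completely evaluated are those in `Ev`. -/
structure IsFinal (v : V) (t : Entry V) : Prop where
  parent : ∀ p, t.parent = some p ↔ IsPred I w p v
  key : t.key = sourceDist I w v
  lt_top : sourceDist I w v < ∞
  b_ne_top : t.b ≠ ⊤
  b_eq_zero : t.b = 0 ↔ v ∈ Ev
  l_eq_zero : t.b = 0 → t.l = 0

/-- The entry `t` of `v` is unset, or it was obtained by attaching `v` through an unevaluated edge
to a vertex whose key is its distance. -/
def IsTentative (v : V) (t : Entry V) : Prop :=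
  (t.parent = none ∧ t.key = ∞) ∨
    ∃ p, t.parent = some p ∧ (p, v) ∈ I.edges ∧ w (p, v) < ∞ ∧ sourceDist I w p < ∞ ∧
      t.key = sourceDist I w p + w (p, v) ∧ t.b ≠ 0 ∧ t.b ≠ ⊤

variable {I w Ev} {v p : V} {t : Entry V}

lemma IsTentative.sourceDist_le [Finite V] (h : IsTentative I w v t) :
    sourceDist I w v ≤ t.key := by
  rcases h with ⟨-, h⟩ | ⟨p, -, hpv, -, -, hkey, -⟩
  · simp [h]
  · exact hkey ▸ sourceDist_le_add hpv

lemma IsTentative.isFinal [Finite V] (hw : IsWeight I w) (h : IsTentative I w v t)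
    (hle : t.key ≤ sourceDist I w v) (hv : sourceDist I w v < ∞) (hEv : v ∉ Ev) :
    IsFinal I w Ev v t := by
  have hkey := le_antisymm hle h.sourceDist_le
  rcases h with ⟨-, h⟩ | ⟨p, hpar, hpv, hwp, hdp, hkeyp, hb0, hbtop⟩
  · exact absurd hv (not_lt.2 (h ▸ hle))
  · have hp : IsPred I w p v := isPred_of_add_le hpv hdp hwp (hkeyp ▸ hle)
    refine ⟨fun q ↦ ⟨fun hq ↦ ?_, fun hq ↦ hpar.trans (congrArg some (hp.unique hw hq))⟩,
      hkey, hv, hbtop, by simp [hb0, hEv], fun h ↦ absurd h hb0⟩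
    exact Option.some_injective _ (hpar.symm.trans hq) ▸ hp

lemma isFinal_source (hw : IsWeight I w) (hs : I.source ∈ Ev) :
    IsFinal I w Ev I.source ⟨none, 0, 0, 0⟩ :=
  ⟨fun p ↦ by simpa using not_isPred_source hw p, by simp [Entry.key], by simp, by simp,
    by simpa using hs, fun _ ↦ rfl⟩

end Entries

section Queues

namespace LRAState

variable {V : Type u} {I : Input V} {s : LRAState V} {Q : Finset V} {q v x : V}

lemma top_mem (I : Input V) (s : LRAState V) (h : Q.Nonempty) : s.top I Q ∈ Q := by
  rw [top, dif_pos h]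
  exact (Q.exists_min_image _ h).choose_spec.1

lemma key_top_le (hq : q ∈ Q) : (s.node (s.top I Q)).key ≤ (s.node q).key := by
  have h : Q.Nonempty := ⟨q, hq⟩
  rw [top, dif_pos h]
  exact (Q.exists_min_image (fun v ↦ (s.node v).key) h).choose_spec.2 q hq

lemma mem_subtree : x ∈ s.subtree v ↔
    x ∈ s.T ∧ Relation.ReflTransGen (fun a b ↦ (s.node a).parent = some b) x v := by
  simp [subtree]

end LRAState

end Queues

section Band

variable {V : Type u} [DecidableEq V] {I : Input V} {E : Finset (V × V)} {Ev : Set V}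
  {e : V × V} {p v x : V}

/-- The weights that determine the search tree of LRA* when `E` are the edges not yet found to be
in collision: lazy weights, except that the search does not leave the target. -/
noncomputable def bandWeight (I : Input V) (E : Finset (V × V)) (e : V × V) : ℝ≥0∞ :=
  if e ∈ E ∧ e.1 ≠ I.target then I.lazyW e else ∞

lemma isWeight_bandWeight (I : Input V) (E : Finset (V × V)) : IsWeight I (bandWeight I E) := by
  intro e _
  unfold bandWeight
  split <;> simp

lemma bandWeight_lt_top : bandWeight I E e < ∞ ↔ e ∈ E ∧ e.1 ≠ I.target := by
  unfold bandWeight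
  split <;> simp_all

lemma IsPred.mem_and_ne_target (h : IsPred I (bandWeight I E) p v) :
    (p, v) ∈ E ∧ p ≠ I.target :=
  bandWeight_lt_top.1 h.weight_lt_top

namespace LRAState

variable {s : LRAState V}

lemma key_childEntry (hp : (s.node p).key = sourceDist I (bandWeight I E) p)
    (hpv : (p, v) ∈ E) (hpt : p ≠ I.target) :
    (s.childEntry I p v).key =
      sourceDist I (bandWeight I E) p + bandWeight I E (p, v) := by
  rw [bandWeight, if_pos ⟨hpv, hpt⟩, ← hp]
  simp [childEntry, Entry.key, add_assoc]

lemma key_childEntry_of_isPred (hp : (s.node p).key = sourceDist I (bandWeight I E) p)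
    (h : IsPred I (bandWeight I E) p v) :
    (s.childEntry I p v).key = sourceDist I (bandWeight I E) v := by
  rw [key_childEntry hp h.mem_and_ne_target.1 h.mem_and_ne_target.2, h.2.1]

lemma isTentative_childEntry (hE : E ⊆ I.edges)
    (hp : IsFinal I (bandWeight I E) Ev p (s.node p)) (hpv : (p, v) ∈ E) (hpt : p ≠ I.target) :
    IsTentative I (bandWeight I E) v (s.childEntry I p v) :=
  .inr ⟨p, rfl, hE hpv, bandWeight_lt_top.2 ⟨hpv, hpt⟩, hp.lt_top, key_childEntry hp.key hpv hpt,
    by simp [childEntry], by simpa [childEntry] using hp.b_ne_top⟩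

lemma isPred_of_key_childEntry_le [Finite V] (hE : E ⊆ I.edges)
    (hp : IsFinal I (bandWeight I E) Ev p (s.node p)) (hpv : (p, v) ∈ E) (hpt : p ≠ I.target)
    (hle : (s.childEntry I p v).key ≤ sourceDist I (bandWeight I E) v) :
    IsPred I (bandWeight I E) p v :=
  isPred_of_add_le (hE hpv) hp.lt_top (bandWeight_lt_top.2 ⟨hpv, hpt⟩)
    (key_childEntry hp.key hpv hpt ▸ hle)

lemma isAncestor_of_parent
    (hx : ∀ y, IsAncestor I (bandWeight I E) y x → IsFinal I (bandWeight I E) Ev y (s.node y))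
    (h : Relation.ReflTransGen (fun a b ↦ (s.node a).parent = some b) x v) :
    IsAncestor I (bandWeight I E) v x := by
  induction h with
  | refl => exact .refl
  | tail _ h ih => exact .head (((hx _ ih).parent _).1 h) ih

end LRAState

end Band

/-! ### Extending the search tree -/

namespace LRAState

section Extend

variable {V : Type u} [DecidableEq V] (I : Input V) (Ev : Set V) (E : Finset (V × V))

/-- The parts of the state that extending the search tree does not touch. -/
structure Quiet (E : Finset (V × V)) (s : LRAState V) : Prop where
  E_eq : s.E = E
  result : s.result = none
  Qupdate : s.Qupdate = ∅
  Qrewire : s.Qrewire = ∅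
  Trewire : s.Trewire = ∅

/-- The invariant of `extendBand` for lookahead `⊤`. The edges in `pending` leave an extended
vertex but have not been processed yet. -/
structure ExtendInv (pending : Set (V × V)) (s : LRAState V) : Prop where
  quiet : Quiet E s
  le_key : ∀ x, sourceDist I (bandWeight I E) x ≤ (s.node x).key
  key_lt : ∀ x ∈ s.T, (s.node x).key < ∞
  subset : s.Qextend ⊆ s.T
  child : ∀ q x, IsPred I (bandWeight I E) q x → q ∈ s.T → q ∉ s.Qextend → (q, x) ∉ pending →
    x ∈ s.T ∧ IsFinal I (bandWeight I E) Ev x (s.node x)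
  final : ∀ x ∈ s.T, x ∉ s.Qextend → IsFinal I (bandWeight I E) Ev x (s.node x)
  evaluated : ∀ x ∈ Ev, x ∈ s.T ∧ IsFinal I (bandWeight I E) Ev x (s.node x)
  notMem_evaluated : ∀ q ∈ s.Qextend, ∀ x, IsPred I (bandWeight I E) q x → x ∉ Ev
  target : I.target ∈ s.T → I.target ∈ s.Qextend ∨ I.target ∈ s.Qfrontier
  frontier : ∀ x ∈ s.Qfrontier, x = I.target ∧ x ∈ s.T

/-- `Ev` is an initial part of the shortest-path tree, as the set of the vertices to which the
shortest path is evaluated always is. -/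
structure IsInitial : Prop where
  source : I.source ∈ Ev
  closed : ∀ p x, IsPred I (bandWeight I E) p x → x ∈ Ev → p ∈ Ev

/-- All vertices of the shortest path to `x` are in the search tree and have been extended. -/
def IsSettled (s : LRAState V) (x : V) : Prop :=
  ∀ y, IsAncestor I (bandWeight I E) y x → y ∈ s.T ∧ y ∉ s.Qextend

/-- The nodes that are removed from the search tree before `v` is attached to a new parent. -/
noncomputable def detached (s : LRAState V) (v : V) : Finset V :=
  if v ∈ s.T then s.subtree v else ∅

variable {I Ev E} {pending : Set (V × V)} {s : LRAState V} {p v x : V}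

lemma IsSettled.mono {y : V} (hx : IsSettled I E s x) (hyx : IsAncestor I (bandWeight I E) y x) :
    IsSettled I E s y := fun z hz ↦ hx z (hz.trans hyx)

lemma isInitial_singleton : IsInitial I {I.source} E :=
  ⟨rfl, fun p _ h hx ↦ absurd (Set.mem_singleton_iff.1 hx ▸ h)
    (not_isPred_source (isWeight_bandWeight I E) p)⟩

lemma mem_of_mem_detached (hx : x ∈ s.detached v) :
    x ∈ s.T ∧ Relation.ReflTransGen (fun a b ↦ (s.node a).parent = some b) x v := by
  unfold detached at hx
  split at hx
  · exact mem_subtree.1 hx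
  · exact absurd hx (Finset.notMem_empty x)

lemma parent_mem_detached (hx : x ∈ s.detached v) (hxv : x ≠ v) (hp : p ∈ s.T)
    (hpar : (s.node x).parent = some p) : p ∈ s.detached v := by
  unfold detached at hx ⊢
  split at hx
  case isFalse => exact absurd hx (Finset.notMem_empty x)
  case isTrue hv =>
    rw [if_pos hv]
    rcases Relation.ReflTransGen.cases_head (mem_subtree.1 hx).2 with h | ⟨c, hc, hcv⟩
    · exact absurd h hxv
    · obtain rfl := Option.some_injective _ (hpar.symm.trans hc)
      exact mem_subtree.2 ⟨hp, hcv⟩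

lemma extendChild_of_gt (h : (s.childEntry I p v).key > (s.node v).key) :
    extendChild I ⊤ p s v = s := if_pos h

lemma extendChild_of_le (h : (s.childEntry I p v).key ≤ (s.node v).key)
    (hb : (s.node p).b ≠ ⊤) :
    extendChild I ⊤ p s v =
      { s with
        node := Function.update s.node v (s.childEntry I p v)
        T := insert v (s.T \ s.detached v)
        Qfrontier := s.Qfrontier \ s.detached v
        Qextend := insert v (s.Qextend \ s.detached v) } := by
  have hb' : (s.childEntry I p v).b ≠ ⊤ := by simpa [childEntry] using hb
  by_cases hv : v ∈ s.T <;> simp [extendChild, h, hb', hv, setNode, detached]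

lemma isPred_of_isFinal [Finite V] (hE : E ⊆ I.edges)
    (hp : IsFinal I (bandWeight I E) Ev p (s.node p)) (hpv : (p, v) ∈ E) (hpt : p ≠ I.target)
    (hle : (s.childEntry I p v).key ≤ (s.node v).key)
    (hv : IsFinal I (bandWeight I E) Ev v (s.node v)) : IsPred I (bandWeight I E) p v :=
  isPred_of_key_childEntry_le hE hp hpv hpt (hv.key ▸ hle)

/-- A settled vertex is removed from the tree only if it descends from `v`; then `v` is settled,
too, and can be reattached to `p` only if `p` is its parent already. -/
lemma ExtendInv.isSettled_extendChild [Finite V] (hE : E ⊆ I.edges)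
    (h : ExtendInv I Ev E pending s) (hp : IsFinal I (bandWeight I E) Ev p (s.node p))
    (hpv : (p, v) ∈ E) (hpt : p ≠ I.target) (hx : IsSettled I E s x)
    (hpx : ¬ IsProperAncestor I (bandWeight I E) p x) :
    IsSettled I E (extendChild I ⊤ p s v) x := by
  by_cases hlt : (s.childEntry I p v).key > (s.node v).key
  · rwa [extendChild_of_gt hlt]
  have hv : ¬ IsAncestor I (bandWeight I E) v x := fun hvx ↦ by
    have hfinal := h.final v (hx v hvx).1 (hx v hvx).2
    exact hpx (.head' (isPred_of_isFinal hE hp hpv hpt (not_lt.1 hlt) hfinal) hvx)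
  rw [extendChild_of_le (not_lt.1 hlt) hp.b_ne_top]
  intro y hy
  have hyv : y ≠ v := by
    rintro rfl
    exact hv hy
  have hyR : y ∉ s.detached v := fun hyR ↦ by
    have hanc := isAncestor_of_parent
      (fun z hz ↦ h.final z (hx z (hz.trans hy)).1 (hx z (hz.trans hy)).2)
      (mem_of_mem_detached hyR).2
    exact hv (hanc.trans hy)
  simp [hyv, hyR, hx y hy]

lemma IsInitial.mem_of_isAncestor (hEv : IsInitial I Ev E)
    (hpx : IsAncestor I (bandWeight I E) p x) (hx : x ∈ Ev) : p ∈ Ev := by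
  induction hpx using Relation.ReflTransGen.head_induction_on with
  | refl => exact hx
  | head h _ ih => exact hEv.closed _ _ h ih

lemma ExtendInv.notMem_detached (hEv : IsInitial I Ev E) (h : ExtendInv I Ev E pending s)
    (hv : v ∉ Ev) (hx : x ∈ Ev) : x ∉ s.detached v := fun hxR ↦
  hv (hEv.mem_of_isAncestor (isAncestor_of_parent
    (fun y hy ↦ (h.evaluated y (hEv.mem_of_isAncestor hy hx)).2) (mem_of_mem_detached hxR).2) hx)

lemma ExtendInv.child_attach [Finite V] (hE : E ⊆ I.edges)
    (h : ExtendInv I Ev E (insert (p, v) pending) s)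
    (hp : IsFinal I (bandWeight I E) Ev p (s.node p)) (hpv : (p, v) ∈ E) (hpt : p ≠ I.target)
    (hle : (s.childEntry I p v).key ≤ (s.node v).key) (hv : v ∉ Ev) {q : V}
    (hqx : IsPred I (bandWeight I E) q x) (hq : q ∈ s.T \ s.detached v) (hqQ : q ∉ s.Qextend)
    (hqx' : (q, x) ∉ pending) :
    x ∈ insert v (s.T \ s.detached v) ∧ IsFinal I (bandWeight I E) Ev x
      (Function.update s.node v (s.childEntry I p v) x) := by
  have hw := isWeight_bandWeight I E
  obtain ⟨hqT, hqR⟩ := Finset.mem_sdiff.1 hq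
  rcases eq_or_ne x v with rfl | hxv
  · have hqp : q = p := by
      by_contra hne
      have hx := (h.child q x hqx hqT hqQ (by simp [hne, hqx'])).2
      exact hne (hqx.unique hw (isPred_of_isFinal hE hp hpv hpt hle hx))
    subst hqp
    rw [Function.update_self]
    exact ⟨Finset.mem_insert_self _ _, (isTentative_childEntry hE hp hpv hpt).isFinal hw
      (key_childEntry_of_isPred hp.key hqx).le hqx.2.2 hv⟩
  · obtain ⟨hxT, hx⟩ := h.child q x hqx hqT hqQ (by simp [hxv, hqx'])
    have hxR : x ∉ s.detached v := fun hxR ↦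
      hqR (parent_mem_detached hxR hxv hqT ((hx.parent q).2 hqx))
    simp [hxv, hxT, hxR, hx]

lemma ExtendInv.of_key_childEntry_gt
    (h : ExtendInv I Ev E (insert (p, v) pending) s)
    (hp : (s.node p).key = sourceDist I (bandWeight I E) p)
    (hgt : (s.childEntry I p v).key > (s.node v).key) : ExtendInv I Ev E pending s := by
  refine { h with child := fun q x hqx hq hqQ hpend ↦ h.child q x hqx hq hqQ ?_ }
  rintro (hqv | hqv)
  · obtain ⟨rfl, rfl⟩ := Prod.ext_iff.1 hqv
    exact (h.le_key x).not_gt (key_childEntry_of_isPred hp hqx ▸ hgt)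
  · exact hpend hqv

lemma ExtendInv.key_lt_attach (h : ExtendInv I Ev E pending s)
    (hp : IsFinal I (bandWeight I E) Ev p (s.node p)) (hpv : (p, v) ∈ E) (hpt : p ≠ I.target)
    (hx : x ∈ insert v s.T) :
    (Function.update s.node v (s.childEntry I p v) x).key < ∞ := by
  rcases eq_or_ne x v with rfl | hxv
  · rw [Function.update_self, key_childEntry hp.key hpv hpt]
    exact ENNReal.add_lt_top.2 ⟨hp.lt_top, bandWeight_lt_top.2 ⟨hpv, hpt⟩⟩
  · rw [Function.update_of_ne hxv]
    exact h.key_lt x (Finset.mem_of_mem_insert_of_ne hx hxv)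

lemma ExtendInv.attach [Finite V] (hE : E ⊆ I.edges) (hEv : IsInitial I Ev E)
    (h : ExtendInv I Ev E (insert (p, v) pending) s)
    (hp : IsFinal I (bandWeight I E) Ev p (s.node p)) (hpv : (p, v) ∈ E) (hpt : p ≠ I.target)
    (hle : (s.childEntry I p v).key ≤ (s.node v).key) (hv : v ∉ Ev) :
    ExtendInv I Ev E pending (extendChild I ⊤ p s v) := by
  have htent := isTentative_childEntry hE hp hpv hpt
  rw [extendChild_of_le hle hp.b_ne_top]
  have hne : ∀ x, x ∉ insert v (s.Qextend \ s.detached v) → x ∈ insert v (s.T \ s.detached v) →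
      x ≠ v ∧ x ∈ s.T \ s.detached v ∧ x ∉ s.Qextend := by
    simp only [Finset.mem_insert, Finset.mem_sdiff]
    tauto
  constructor
  case quiet => exact { h.quiet with }
  case le_key =>
    exact (Function.forall_update_iff s.node fun x t ↦ sourceDist I (bandWeight I E) x ≤ t.key).2
      ⟨htent.sourceDist_le, fun x _ ↦ h.le_key x⟩
  case key_lt =>
    exact fun x hx ↦ h.key_lt_attach hp hpv hpt <|
      Finset.insert_subset_insert _ Finset.sdiff_subset hx
  case subset => exact Finset.insert_subset_insert _ (Finset.sdiff_subset_sdiff h.subset subset_rfl)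
  case child =>
    intro q x hqx hq hqQ hpend
    obtain ⟨-, hq, hqQ⟩ := hne q hqQ hq
    exact h.child_attach hE hp hpv hpt hle hv hqx hq hqQ hpend
  case final =>
    intro x hx hxQ
    obtain ⟨hxv, hx, hxQ⟩ := hne x hxQ hx
    simpa [hxv] using h.final x (Finset.mem_sdiff.1 hx).1 hxQ
  case evaluated =>
    intro x hx
    have hxv : x ≠ v := ne_of_mem_of_not_mem hx hv
    simpa [hxv, h.notMem_detached hEv hv hx] using h.evaluated x hx
  case notMem_evaluated =>
    intro q hq x hqx hx
    rcases Finset.mem_insert.1 hq with rfl | hq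
    · exact hv (hEv.closed _ _ hqx hx)
    · exact h.notMem_evaluated q (Finset.mem_sdiff.1 hq).1 x hqx hx
  case target =>
    have := h.target
    simp only [Finset.mem_insert, Finset.mem_sdiff]
    tauto
  case frontier =>
    have := h.frontier
    simp only [Finset.mem_insert, Finset.mem_sdiff]
    grind

lemma ExtendInv.extendChild [Finite V] (hE : E ⊆ I.edges) (hEv : IsInitial I Ev E)
    (h : ExtendInv I Ev E (insert (p, v) pending) s)
    (hp : IsFinal I (bandWeight I E) Ev p (s.node p)) (hpv : (p, v) ∈ E) (hpt : p ≠ I.target)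
    (hpEv : ∀ x, IsPred I (bandWeight I E) p x → x ∉ Ev) :
    ExtendInv I Ev E pending (extendChild I ⊤ p s v) := by
  by_cases hgt : (s.childEntry I p v).key > (s.node v).key
  · rw [extendChild_of_gt hgt]
    exact h.of_key_childEntry_gt hp.key hgt
  · have hle := not_lt.1 hgt
    exact h.attach hE hEv hp hpv hpt hle fun hv ↦
      hpEv v (isPred_of_isFinal hE hp hpv hpt hle (h.evaluated v hv).2) hv

lemma ExtendInv.mem_of_isProperAncestor_top [Finite V] (hEv : IsInitial I Ev E)
    (h : ExtendInv I Ev E ∅ s) (hne : s.Qextend.Nonempty) {q : V}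
    (hq : IsProperAncestor I (bandWeight I E) q (s.top I s.Qextend)) :
    q ∈ s.T ∧ q ∉ s.Qextend := by
  have hp := top_mem I s hne
  refine (dijkstra_key_eq (isWeight_bandWeight I E) (S := {x | x ∈ s.T ∧ x ∉ s.Qextend})
    (Q := s.Qextend) (key := fun x ↦ (s.node x).key) ?_ ?_ (h.le_key _) (fun q ↦ key_top_le)
    (fun h ↦ h.2 hp) ((h.le_key _).trans_lt (h.key_lt _ (h.subset hp)))).2 q hq
  · intro hs
    obtain ⟨hT, hfinal⟩ := h.evaluated _ hEv.source
    exact ⟨by simpa [hT] using hs, by simp [hfinal.key]⟩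
  · intro x hx y hy hxy
    obtain ⟨hT, hfinal⟩ := h.child x y hxy hx.1 hx.2 (Set.notMem_empty _)
    exact ⟨by simpa [hT] using hy, hfinal.key.le⟩

lemma ExtendInv.isFinal_top [Finite V] (hEv : IsInitial I Ev E) (h : ExtendInv I Ev E ∅ s)
    (hne : s.Qextend.Nonempty) :
    IsFinal I (bandWeight I E) Ev (s.top I s.Qextend) (s.node (s.top I s.Qextend)) := by
  by_cases hs : s.top I s.Qextend = I.source
  · rw [hs]
    exact (h.evaluated _ hEv.source).2
  · obtain ⟨q, hq⟩ := exists_isPred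
      ((h.le_key _).trans_lt (h.key_lt _ (h.subset (top_mem I s hne)))) hs
    obtain ⟨hqT, hqQ⟩ := h.mem_of_isProperAncestor_top hEv hne (.single hq)
    exact (h.child q _ hq hqT hqQ (Set.notMem_empty _)).2

lemma ExtendInv.isSettled_erase_top [Finite V] (hEv : IsInitial I Ev E)
    (h : ExtendInv I Ev E ∅ s) (hne : s.Qextend.Nonempty) :
    IsSettled I E { s with Qextend := s.Qextend.erase (s.top I s.Qextend) }
      (s.top I s.Qextend) := by
  intro q hq
  rcases Relation.reflTransGen_iff_eq_or_transGen.1 hq with hq | hq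
  · exact ⟨hq ▸ h.subset (top_mem I s hne), by simp [← hq]⟩
  · obtain ⟨hqT, hqQ⟩ := h.mem_of_isProperAncestor_top hEv hne hq
    exact ⟨hqT, fun hq ↦ hqQ (Finset.mem_of_mem_erase hq)⟩

lemma IsSettled.erase (h : IsSettled I E s x) :
    IsSettled I E { s with Qextend := s.Qextend.erase p } x := fun y hy ↦
  ⟨(h y hy).1, fun hQ ↦ (h y hy).2 (Finset.mem_of_mem_erase hQ)⟩

lemma ExtendInv.final_erase (h : ExtendInv I Ev E pending s)
    (hp : IsFinal I (bandWeight I E) Ev p (s.node p)) (hx : x ∈ s.T)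
    (hxQ : x ∉ s.Qextend.erase p) : IsFinal I (bandWeight I E) Ev x (s.node x) := by
  rcases eq_or_ne x p with rfl | hxp
  · exact hp
  · exact h.final x hx fun h ↦ hxQ (Finset.mem_erase.2 ⟨hxp, h⟩)

lemma ExtendInv.erase (h : ExtendInv I Ev E ∅ s)
    (hp : IsFinal I (bandWeight I E) Ev p (s.node p)) (hpt : p ≠ I.target)
    (hpending : ∀ x, (p, x) ∈ E → (p, x) ∈ pending) :
    ExtendInv I Ev E pending { s with Qextend := s.Qextend.erase p } where
  quiet := { h.quiet with }
  le_key := h.le_key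
  key_lt := h.key_lt
  subset := (Finset.erase_subset _ _).trans h.subset
  child q x hqx hq hqQ hpend := by
    have hqp : q ≠ p := by
      rintro rfl
      exact hpend (hpending x hqx.mem_and_ne_target.1)
    exact h.child q x hqx hq (fun hQ ↦ hqQ (Finset.mem_erase.2 ⟨hqp, hQ⟩)) (Set.notMem_empty _)
  final _ := h.final_erase hp
  evaluated := h.evaluated
  notMem_evaluated q hq := h.notMem_evaluated q (Finset.mem_of_mem_erase hq)
  target ht := (h.target ht).imp_left fun hQ ↦ Finset.mem_erase.2 ⟨hpt.symm, hQ⟩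
  frontier := h.frontier

lemma ExtendInv.erase_target (h : ExtendInv I Ev E ∅ s)
    (ht : IsFinal I (bandWeight I E) Ev I.target (s.node I.target)) (htT : I.target ∈ s.T) :
    ExtendInv I Ev E ∅ { s with
      Qextend := s.Qextend.erase I.target
      Qfrontier := insert I.target s.Qfrontier } where
  quiet := { h.quiet with }
  le_key := h.le_key
  key_lt := h.key_lt
  subset := (Finset.erase_subset _ _).trans h.subset
  child q x hqx hq hqQ := h.child q x hqx hq fun hQ ↦
    hqQ (Finset.mem_erase.2 ⟨hqx.mem_and_ne_target.2, hQ⟩)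
  final _ := h.final_erase ht
  evaluated := h.evaluated
  notMem_evaluated q hq := h.notMem_evaluated q (Finset.mem_of_mem_erase hq)
  target _ := .inr (Finset.mem_insert_self _ _)
  frontier x hx := (Finset.mem_insert.1 hx).elim (fun h ↦ ⟨h, h ▸ htT⟩) (h.frontier x)

variable (I Ev E) in
/-- The invariant of processing the successors of `p`, which was taken from the queue of the state
`s₀`; those in `L` remain. -/
structure ExtendFoldInv (s₀ : LRAState V) (p : V) (L : List V) (s : LRAState V) : Prop where
  inv : ExtendInv I Ev E ({p} ×ˢ {v | v ∈ L}) s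
  mem : ∀ v ∈ L, (p, v) ∈ E
  isSettled : IsSettled I E s p
  isSettled_mono : ∀ x, IsSettled I E s₀ x → IsSettled I E s x

lemma ExtendFoldInv.step [Finite V] {s₀ : LRAState V} {L : List V} (hE : E ⊆ I.edges)
    (hEv : IsInitial I Ev E) (hp : ¬ IsSettled I E s₀ p) (hpt : p ≠ I.target)
    (hpEv : ∀ x, IsPred I (bandWeight I E) p x → x ∉ Ev)
    (h : ExtendFoldInv I Ev E s₀ p (v :: L) s) :
    ExtendFoldInv I Ev E s₀ p L (extendChild I ⊤ p s v) := by
  obtain ⟨hpT, hpQ⟩ := h.isSettled p .refl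
  have hfinal := h.inv.final p hpT hpQ
  have hpv := h.mem v List.mem_cons_self
  refine ⟨(singleton_prod_mem_cons p v L ▸ h.inv).extendChild hE hEv hfinal hpv hpt hpEv,
    fun x hx ↦ h.mem x (List.mem_cons_of_mem v hx),
    h.inv.isSettled_extendChild hE hfinal hpv hpt h.isSettled fun hpp ↦
      (IsProperAncestor.sourceDist_lt (isWeight_bandWeight I E) hpp).false,
    fun x hx ↦ h.inv.isSettled_extendChild hE hfinal hpv hpt (h.isSettled_mono x hx) fun hpx ↦
      hp (hx.mono hpx.to_reflTransGen)⟩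

variable (I Ev E) in
/-- The invariant of the main loop of LRA* with lookahead `⊤`: the search tree is the complete
shortest-path tree, in which the edges to the vertices in `Ev` are evaluated. -/
structure Stable (s : LRAState V) : Prop where
  quiet : Quiet E s
  Qextend : s.Qextend = ∅
  mem_T : ∀ x, x ∈ s.T ↔ sourceDist I (bandWeight I E) x < ∞
  le_key : ∀ x, sourceDist I (bandWeight I E) x ≤ (s.node x).key
  final : ∀ x ∈ s.T, IsFinal I (bandWeight I E) Ev x (s.node x)
  frontier : ∀ x, x ∈ s.Qfrontier ↔ x = I.target ∧ x ∈ s.T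

lemma ExtendInv.stable [Finite V] (hEv : IsInitial I Ev E) (h : ExtendInv I Ev E ∅ s)
    (hQ : s.Qextend = ∅) : Stable I Ev E s where
  quiet := h.quiet
  Qextend := hQ
  mem_T x := by
    refine ⟨fun hx ↦ (h.le_key x).trans_lt (h.key_lt x hx), fun hx ↦ ?_⟩
    exact sourceDist_induction (motive := (· ∈ s.T)) (h.evaluated _ hEv.source).1
      (fun p v hpv hp ↦ (h.child p v hpv hp (by simp [hQ]) (Set.notMem_empty _)).1) hx
  le_key := h.le_key
  final x hx := h.final x hx (by simp [hQ])
  frontier x := by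
    refine ⟨h.frontier x, ?_⟩
    rintro ⟨rfl, hx⟩
    exact (h.target hx).resolve_left (by simp [hQ])

variable [Fintype V]

lemma extendBody_of_top_eq (ht : s.top I s.Qextend = I.target) :
    extendBody I ⊤ s = { s with
      Qextend := s.Qextend.erase I.target
      Qfrontier := insert I.target s.Qfrontier } := by
  simp [extendBody, ht]

lemma extendBody_of_top_ne (ht : s.top I s.Qextend ≠ I.target) :
    extendBody I ⊤ s = (Finset.univ.filter fun v ↦ (s.top I s.Qextend, v) ∈ s.E).toList.foldl
      (LRAState.extendChild I ⊤ (s.top I s.Qextend))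
      { s with Qextend := s.Qextend.erase (s.top I s.Qextend) } :=
  if_neg ht

lemma ExtendInv.extendBody (hE : E ⊆ I.edges) (hEv : IsInitial I Ev E)
    (h : ExtendInv I Ev E ∅ s) (hne : s.Qextend.Nonempty) :
    ExtendInv I Ev E ∅ (extendBody I ⊤ s) ∧
      IsSettled I E (extendBody I ⊤ s) (s.top I s.Qextend) ∧
      ∀ x, IsSettled I E s x → IsSettled I E (extendBody I ⊤ s) x := by
  have hpQ := top_mem I s hne
  have hfinal := h.isFinal_top hEv hne
  have hsettled := h.isSettled_erase_top hEv hne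
  by_cases hpt : s.top I s.Qextend = I.target
  · rw [extendBody_of_top_eq hpt]
    rw [hpt] at hfinal hsettled hpQ ⊢
    exact ⟨h.erase_target hfinal (h.subset hpQ), hsettled, fun x hx ↦ hx.erase⟩
  rw [extendBody_of_top_ne hpt]
  set p := s.top I s.Qextend
  have hfold := foldl_induction (LRAState.extendChild I ⊤ p) (ExtendFoldInv I Ev E s p)
    (fun v L s' h' ↦ h'.step hE hEv (fun hp ↦ (hp p .refl).2 hpQ) hpt (h.notMem_evaluated p hpQ))
    (Finset.univ.filter fun v ↦ (p, v) ∈ s.E).toList _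
    ⟨h.erase hfinal hpt (by simp [h.quiet.E_eq]), by simp [h.quiet.E_eq], hsettled,
      fun x hx ↦ hx.erase⟩
  exact ⟨by simpa using hfold.inv, hfold.isSettled, hfold.isSettled_mono⟩

lemma ExtendInv.stable_extendBand (hE : E ⊆ I.edges) (hEv : IsInitial I Ev E)
    (h : ExtendInv I Ev E ∅ s) : Stable I Ev E (extendBand I ⊤ s) := by
  have hstep : ∀ s, ExtendInv I Ev E ∅ s → s.Qextend.Nonempty →
      ExtendInv I Ev E ∅ (LRAState.extendBody I ⊤ s) ∧
        {x | ¬ IsSettled I E (LRAState.extendBody I ⊤ s) x}.ncard <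
          {x | ¬ IsSettled I E s x}.ncard := by
    intro s hs hne
    obtain ⟨hinv, htop, hmono⟩ := hs.extendBody hE hEv hne
    exact ⟨hinv, Set.ncard_lt_ncard ((Set.ssubset_iff_of_subset fun x hx ↦ mt (hmono x) hx).2
      ⟨s.top I s.Qextend, fun hp ↦ (hp _ .refl).2 (top_mem I s hne), fun hp ↦ hp htop⟩)⟩
  obtain ⟨hinv, hQ⟩ := whileLoop_induction (cond := fun s ↦ s.Qextend.Nonempty)
    (ExtendInv I Ev E ∅) (fun s ↦ {x | ¬ IsSettled I E s x}.ncard) hstep h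
  exact hinv.stable hEv (Finset.not_nonempty_iff_eq_empty.1 hQ)

lemma stable_start (I : Input V) : Stable I {I.source} I.edges (start I ⊤) := by
  have hw := isWeight_bandWeight I I.edges
  refine ExtendInv.stable_extendBand subset_rfl isInitial_singleton ?_
  constructor
  case quiet => exact ⟨rfl, rfl, rfl, rfl, rfl⟩
  case le_key =>
    intro x
    by_cases hx : x = I.source <;> simp [hx, Entry.unset, Entry.key]
  case key_lt => simp [Entry.key]
  case subset => exact subset_rfl
  case child => exact fun q x _ hq hqQ ↦ absurd hq hqQ
  case final => exact fun x hx hxQ ↦ absurd hx hxQ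
  case evaluated =>
    rintro x rfl
    simpa using isFinal_source (Ev := {I.source}) hw rfl
  case notMem_evaluated =>
    rintro q - x hqx rfl
    exact not_isPred_source hw q hqx
  case target => exact .inl
  case frontier => simp

end Extend

end LRAState

/-! ### Updating the search tree -/

namespace LRAState

section Update

variable {V : Type u} [DecidableEq V] (I : Input V) (Ev : Set V) (E : Finset (V × V))

/-- The invariant of `updateBand` for lookahead `⊤`. The vertices in `pending` are still to be
inserted in the queue. -/
structure UpdateInv (pending : Set V) (s : LRAState V) : Prop where
  E_eq : s.E = E
  result : s.result = none
  Qrewire : s.Qrewire = ∅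
  Trewire : s.Trewire = ∅
  Qfrontier : s.Qfrontier = ∅
  mem_T : ∀ x, x ∈ s.T ↔ sourceDist I (bandWeight I E) x < ∞
  le_key : ∀ x, sourceDist I (bandWeight I E) x ≤ (s.node x).key
  final : ∀ x ∈ s.T, IsFinal I (bandWeight I E) Ev x (s.node x)
  subset : s.Qupdate ∪ s.Qextend ⊆ s.T
  notMem_evaluated :
    ∀ q ∈ s.Qupdate ∪ s.Qextend, ∀ x, IsPred I (bandWeight I E) q x → x ∉ Ev
  target : I.target ∈ s.Qextend ∨
    ∃ y, (y ∈ s.Qupdate ∨ y ∈ pending) ∧ IsAncestor I (bandWeight I E) y I.target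

variable {I Ev E} {pending : Set V} {s : LRAState V} {p v x : V}

lemma UpdateInv.updateChild [Finite V] (hE : E ⊆ I.edges) (hEv : IsInitial I Ev E)
    (h : UpdateInv I Ev E (insert v pending) s) (hpv : IsPred I (bandWeight I E) p v)
    (hv : v ∉ Ev) : UpdateInv I Ev E pending (updateChild I ⊤ p s v) := by
  have hvT : v ∈ s.T := (h.mem_T v).2 hpv.2.2
  have hp := h.final p ((h.mem_T p).2 hpv.sourceDist_fst_lt_top)
  have hvfinal : IsFinal I (bandWeight I E) Ev v (s.childEntry I p v) :=
    (isTentative_childEntry hE hp hpv.mem_and_ne_target.1 hpv.mem_and_ne_target.2).isFinal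
      (isWeight_bandWeight I E) (key_childEntry_of_isPred hp.key hpv).le hpv.2.2 hv
  have heq : LRAState.updateChild I ⊤ p s v =
      { s with
        node := Function.update s.node v (s.childEntry I p v)
        Qupdate := insert v s.Qupdate } := by
    simp [LRAState.updateChild, (h.final v hvT).b_ne_top, setNode]
  rw [heq]
  refine { h with le_key := ?_, final := ?_, subset := ?_, notMem_evaluated := ?_, target := ?_ }
  · exact (Function.forall_update_iff s.node fun x t ↦ sourceDist I (bandWeight I E) x ≤ t.key).2
      ⟨hvfinal.key.ge, fun x _ ↦ h.le_key x⟩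
  · exact (Function.forall_update_iff s.node fun x t ↦
      x ∈ s.T → IsFinal I (bandWeight I E) Ev x t).2 ⟨fun _ ↦ hvfinal, fun x _ ↦ h.final x⟩
  · rw [Finset.insert_union]
    exact Finset.insert_subset hvT h.subset
  · intro q hq x hqx hx
    rw [Finset.insert_union] at hq
    rcases Finset.mem_insert.1 hq with rfl | hq
    · exact hv (hEv.closed _ _ hqx hx)
    · exact h.notMem_evaluated q hq x hqx hx
  · refine h.target.imp_right fun ⟨y, hy, hyt⟩ ↦ ⟨y, ?_, hyt⟩
    simp only [Finset.mem_insert, Set.mem_insert_iff] at hy ⊢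
    tauto

lemma UpdateInv.mem_children_iff (h : UpdateInv I Ev E pending s) :
    (v ∈ s.T.filter fun v ↦ (s.node v).parent = some p) ↔ IsPred I (bandWeight I E) p v := by
  rw [Finset.mem_filter]
  refine ⟨fun ⟨hv, hpar⟩ ↦ ((h.final v hv).parent p).1 hpar, fun hpv ↦ ?_⟩
  have hv := (h.mem_T v).2 hpv.2.2
  exact ⟨hv, ((h.final v hv).parent p).2 hpv⟩

lemma UpdateInv.sourceDist_top_le (h : UpdateInv I Ev E pending s) {q : V} (hq : q ∈ s.Qupdate) :
    sourceDist I (bandWeight I E) (s.top I s.Qupdate) ≤ sourceDist I (bandWeight I E) q := by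
  have hT : s.Qupdate ⊆ s.T := Finset.subset_union_left.trans h.subset
  rw [← (h.final q (hT hq)).key, ← (h.final _ (hT (top_mem I s ⟨q, hq⟩))).key]
  exact key_top_le hq

lemma UpdateInv.insert_Qextend (h : UpdateInv I Ev E ∅ s) (hp : p ∈ s.Qupdate)
    (hchildren : ∀ v, ¬ IsPred I (bandWeight I E) p v) :
    UpdateInv I Ev E ∅ { s with
      Qupdate := s.Qupdate.erase p
      Qextend := insert p s.Qextend } := by
  have hQ : s.Qupdate.erase p ∪ insert p s.Qextend = s.Qupdate ∪ s.Qextend := by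
    ext x
    simp only [Finset.mem_union, Finset.mem_erase, Finset.mem_insert]
    grind
  refine { h with subset := ?_, notMem_evaluated := ?_, target := ?_ }
  · exact hQ ▸ h.subset
  · exact hQ ▸ h.notMem_evaluated
  · rcases h.target with ht | ⟨y, hy, hyt⟩
    · exact .inl (Finset.mem_insert_of_mem ht)
    · rcases eq_or_ne y p with rfl | hyp
      · rcases Relation.ReflTransGen.cases_head hyt with rfl | ⟨c, hc, -⟩
        · exact .inl (Finset.mem_insert_self _ _)
        · exact absurd hc (hchildren c)
      · exact .inr ⟨y, by simpa [hyp] using hy, hyt⟩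

lemma UpdateInv.erase (h : UpdateInv I Ev E ∅ s) (hv : IsPred I (bandWeight I E) p v) :
    UpdateInv I Ev E {x | IsPred I (bandWeight I E) p x}
      { s with Qupdate := s.Qupdate.erase p } := by
  have hQ : s.Qupdate.erase p ∪ s.Qextend ⊆ s.Qupdate ∪ s.Qextend :=
    Finset.union_subset_union_left (Finset.erase_subset _ _)
  refine { h with subset := ?_, notMem_evaluated := ?_, target := ?_ }
  · exact hQ.trans h.subset
  · exact fun q hq ↦ h.notMem_evaluated q (hQ hq)
  · refine h.target.imp_right fun ⟨y, hy, hyt⟩ ↦ ?_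
    rcases eq_or_ne y p with rfl | hyp
    · rcases Relation.ReflTransGen.cases_head hyt with rfl | ⟨c, hc, hct⟩
      · exact absurd rfl hv.mem_and_ne_target.2
      · exact ⟨c, .inr hc, hct⟩
    · exact ⟨y, .inl (by simpa [hyp] using hy), hyt⟩

lemma UpdateInv.foldl_updateChild [Finite V] (hE : E ⊆ I.edges) (hEv : IsInitial I Ev E)
    {L : List V} (h : UpdateInv I Ev E {v | v ∈ L} s)
    (hL : ∀ v ∈ L, IsPred I (bandWeight I E) p v ∧ v ∉ Ev) :
    UpdateInv I Ev E ∅ (L.foldl (LRAState.updateChild I ⊤ p) s) ∧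
      (L.foldl (LRAState.updateChild I ⊤ p) s).Qupdate = L.toFinset ∪ s.Qupdate := by
  induction L generalizing s with
  | nil => simpa using h
  | cons v L ih =>
    rw [List.forall_mem_cons] at hL
    rw [List.setOfPred_mem_cons] at h
    obtain ⟨hinv, hQ⟩ := ih (h.updateChild hE hEv hL.1.1 hL.1.2) hL.2
    refine ⟨hinv, hQ.trans ?_⟩
    rw [LRAState.updateChild]
    split <;> simp

lemma updateBody_of_eq_empty
    (h : (s.T.filter fun v ↦ (s.node v).parent = some (s.top I s.Qupdate)) = ∅) :
    updateBody I ⊤ s = { s with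
      Qupdate := s.Qupdate.erase (s.top I s.Qupdate)
      Qextend := insert (s.top I s.Qupdate) s.Qextend } :=
  if_pos h

lemma updateBody_of_nonempty
    (h : (s.T.filter fun v ↦ (s.node v).parent = some (s.top I s.Qupdate)).Nonempty) :
    updateBody I ⊤ s =
      (s.T.filter fun v ↦ (s.node v).parent = some (s.top I s.Qupdate)).toList.foldl
        (LRAState.updateChild I ⊤ (s.top I s.Qupdate))
        { s with Qupdate := s.Qupdate.erase (s.top I s.Qupdate) } :=
  if_neg h.ne_empty

lemma UpdateInv.updateBody [Finite V] (hE : E ⊆ I.edges) (hEv : IsInitial I Ev E)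
    (h : UpdateInv I Ev E ∅ s) (hne : s.Qupdate.Nonempty) :
    UpdateInv I Ev E ∅ (updateBody I ⊤ s) ∧
      ∀ x ∈ (updateBody I ⊤ s).Qupdate,
        x ∈ s.Qupdate.erase (s.top I s.Qupdate) ∨
          IsPred I (bandWeight I E) (s.top I s.Qupdate) x := by
  have hpQ := top_mem I s hne
  have hpEv := h.notMem_evaluated _ (Finset.mem_union_left _ hpQ)
  rcases Finset.eq_empty_or_nonempty
    (s.T.filter fun v ↦ (s.node v).parent = some (s.top I s.Qupdate)) with hchildren | hchildren
  · rw [updateBody_of_eq_empty hchildren]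
    refine ⟨h.insert_Qextend hpQ fun v hv ↦ ?_, fun x hx ↦ .inl hx⟩
    exact absurd (h.mem_children_iff.2 hv) (by simp [hchildren])
  · rw [updateBody_of_nonempty hchildren]
    obtain ⟨c, hc⟩ := hchildren
    obtain ⟨hinv, hQ⟩ := UpdateInv.foldl_updateChild hE hEv
      (L := (s.T.filter fun v ↦ (s.node v).parent = some (s.top I s.Qupdate)).toList)
      (by simpa only [Finset.mem_toList, h.mem_children_iff] using
        h.erase (h.mem_children_iff.1 hc))
      fun v hv ↦ by
        have hv := h.mem_children_iff.1 (Finset.mem_toList.1 hv)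
        exact ⟨hv, hpEv v hv⟩
    refine ⟨hinv, fun x hx ↦ ?_⟩
    rw [hQ, Finset.mem_union, List.mem_toFinset, Finset.mem_toList, h.mem_children_iff] at hx
    exact hx.symm

/-- The vertex taken from the queue has minimal distance, so no vertex that remains in the queue
and none of its own children can be an ancestor of it. -/
lemma UpdateInv.ncard_pending_lt [Finite V] (h : UpdateInv I Ev E ∅ s)
    (hne : s.Qupdate.Nonempty) {s' : LRAState V}
    (hs' : ∀ x ∈ s'.Qupdate, x ∈ s.Qupdate.erase (s.top I s.Qupdate) ∨
      IsPred I (bandWeight I E) (s.top I s.Qupdate) x) :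
    {x | ∃ y ∈ s'.Qupdate, IsAncestor I (bandWeight I E) y x}.ncard <
      {x | ∃ y ∈ s.Qupdate, IsAncestor I (bandWeight I E) y x}.ncard := by
  have hw := isWeight_bandWeight I E
  have hpQ := top_mem I s hne
  refine Set.ncard_lt_ncard ((Set.ssubset_iff_of_subset ?_).2
    ⟨s.top I s.Qupdate, ⟨_, hpQ, .refl⟩, ?_⟩)
  · rintro x ⟨y, hy, hyx⟩
    rcases hs' y hy with hy | hy
    · exact ⟨y, Finset.mem_of_mem_erase hy, hyx⟩
    · exact ⟨_, hpQ, .head hy hyx⟩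
  · rintro ⟨y, hy, hyp⟩
    rcases hs' y hy with hy | hy
    · obtain ⟨hne, hyQ⟩ := Finset.mem_erase.1 hy
      exact (h.sourceDist_top_le hyQ).not_gt (IsProperAncestor.sourceDist_lt hw
        ((Relation.reflTransGen_iff_eq_or_transGen.1 hyp).resolve_left hne.symm))
    · exact (IsProperAncestor.sourceDist_lt hw (.head' hy hyp)).false

lemma UpdateInv.extendInv (hEvd : ∀ x ∈ Ev, sourceDist I (bandWeight I E) x < ∞)
    (h : UpdateInv I Ev E ∅ s) (hQ : s.Qupdate = ∅) : ExtendInv I Ev E ∅ s where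
  quiet := ⟨h.E_eq, h.result, hQ, h.Qrewire, h.Trewire⟩
  le_key := h.le_key
  key_lt x hx := (h.final x hx).key ▸ (h.final x hx).lt_top
  subset := Finset.subset_union_right.trans h.subset
  child _ x hqx _ _ _ := have hx := (h.mem_T x).2 hqx.2.2; ⟨hx, h.final x hx⟩
  final x hx _ := h.final x hx
  evaluated x hx := have hx := (h.mem_T x).2 (hEvd x hx); ⟨hx, h.final x hx⟩
  notMem_evaluated q hq := h.notMem_evaluated q (Finset.mem_union_right _ hq)
  target _ := h.target.imp_right fun ⟨y, hy, _⟩ ↦ by simp [hQ] at hy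
  frontier x hx := by simp [h.Qfrontier] at hx

lemma UpdateInv.extendInv_updateBand [Finite V] (hE : E ⊆ I.edges) (hEv : IsInitial I Ev E)
    (hEvd : ∀ x ∈ Ev, sourceDist I (bandWeight I E) x < ∞) (h : UpdateInv I Ev E ∅ s) :
    ExtendInv I Ev E ∅ (updateBand I ⊤ s) := by
  obtain ⟨hinv, hQ⟩ := whileLoop_induction (cond := fun s ↦ s.Qupdate.Nonempty)
    (UpdateInv I Ev E ∅)
    (fun s ↦ {x | ∃ y ∈ s.Qupdate, IsAncestor I (bandWeight I E) y x}.ncard)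
    (fun s hs hne ↦ (hs.updateBody hE hEv hne).imp_right (hs.ncard_pending_lt hne)) h
  exact hinv.extendInv hEvd (Finset.not_nonempty_iff_eq_empty.1 hQ)

end Update

end LRAState

/-! ### Rewiring the search tree -/

namespace LRAState

section Rewire

variable {V : Type u} [DecidableEq V] (I : Input V) (Ev : Set V) (E : Finset (V × V))

/-- The invariant of the main loop of `rewireBand` for lookahead `⊤`. The edges in `pending` leave
a reattached vertex but have not been relaxed yet. -/
structure RewireInv (pending : Set (V × V)) (s : LRAState V) : Prop where
  E_eq : s.E = E
  result : s.result = none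
  Qupdate : s.Qupdate = ∅
  le_key : ∀ x, sourceDist I (bandWeight I E) x ≤ (s.node x).key
  final : ∀ x ∈ s.T, IsFinal I (bandWeight I E) Ev x (s.node x)
  tentative : ∀ x ∈ s.Qrewire, x ∉ s.T ∧ IsTentative I (bandWeight I E) x (s.node x)
  child : ∀ q x, IsPred I (bandWeight I E) q x → q ∈ s.T → x ∉ s.T → (q, x) ∉ pending →
    (s.node x).key ≤ sourceDist I (bandWeight I E) x
  cover : ∀ x, sourceDist I (bandWeight I E) x < ∞ → x ∈ s.T ∨ x ∈ s.Qrewire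
  evaluated : ∀ x ∈ Ev, x ∈ s.T
  Qextend : ∀ q ∈ s.Qextend, q ∈ s.T ∧ q ∉ Ev
  target : I.target ∈ s.T → I.target ∈ s.Qfrontier
  frontier : ∀ x ∈ s.Qfrontier, x = I.target ∧ x ∈ s.T

variable {I Ev E} {pending : Set (V × V)} {s : LRAState V} {p v x : V}

lemma exists_relax_eq (hE : E ⊆ I.edges) (hp : IsFinal I (bandWeight I E) Ev p (s.node p))
    (hpv : (p, v) ∈ E) (hpt : p ≠ I.target) (hv : IsTentative I (bandWeight I E) v (s.node v)) :
    ∃ t, relax I v s p = { s with node := Function.update s.node v t } ∧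
      IsTentative I (bandWeight I E) v t ∧ t.key ≤ (s.node v).key ∧
      t.key ≤ sourceDist I (bandWeight I E) p + bandWeight I E (p, v) := by
  rw [← key_childEntry hp.key hpv hpt]
  by_cases h : (s.node v).key > (s.childEntry I p v).key
  · exact ⟨_, if_pos h, isTentative_childEntry hE hp hpv hpt, h.le, le_rfl⟩
  · exact ⟨s.node v, (if_neg h).trans (by rw [Function.update_eq_self]), hv, le_rfl, not_lt.1 h⟩

lemma RewireInv.relax [Finite V] (hE : E ⊆ I.edges)
    (h : RewireInv I Ev E (insert (p, v) pending) s) (hp : p ∈ s.T) (hpt : p ≠ I.target)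
    (hpv : (p, v) ∈ E) (hv : v ∈ s.Qrewire) :
    RewireInv I Ev E pending (relax I v s p) ∧ (relax I v s p).T = s.T ∧
      (relax I v s p).Qrewire = s.Qrewire := by
  obtain ⟨hvT, hvtent⟩ := h.tentative v hv
  obtain ⟨t, heq, ht, hle, hlep⟩ := exists_relax_eq hE (h.final p hp) hpv hpt hvtent
  rw [heq]
  refine ⟨{ h with le_key := ?_, final := ?_, tentative := ?_, child := ?_ }, rfl, rfl⟩
  · exact (Function.forall_update_iff s.node fun x t ↦ sourceDist I (bandWeight I E) x ≤ t.key).2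
      ⟨ht.sourceDist_le, fun x _ ↦ h.le_key x⟩
  · exact (Function.forall_update_iff s.node fun x t ↦
      x ∈ s.T → IsFinal I (bandWeight I E) Ev x t).2
      ⟨fun hv ↦ absurd hv hvT, fun x _ ↦ h.final x⟩
  · exact (Function.forall_update_iff s.node fun x t ↦
      x ∈ s.Qrewire → x ∉ s.T ∧ IsTentative I (bandWeight I E) x t).2
      ⟨fun _ ↦ ⟨hvT, ht⟩, fun x _ ↦ h.tentative x⟩
  · intro q x hqx hq hx hpend
    rcases eq_or_ne x v with rfl | hxv
    · simp only [Function.update_self]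
      rcases eq_or_ne q p with rfl | hqp
      · rwa [hqx.2.1]
      · exact hle.trans (h.child q x hqx hq hx (by simp [hqp, hpend]))
    · simp only [Function.update_of_ne hxv]
      exact h.child q x hqx hq hx (by simp [hxv, hpend])

lemma RewireInv.foldl_relax [Finite V] (hE : E ⊆ I.edges) {L : List V}
    (h : RewireInv I Ev E ({p} ×ˢ {v | v ∈ L}) s) (hp : p ∈ s.T) (hpt : p ≠ I.target)
    (hL : ∀ v ∈ L, v ∈ s.Qrewire ∧ (p, v) ∈ E) :
    RewireInv I Ev E ∅ (L.foldl (fun s v ↦ LRAState.relax I v s p) s) ∧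
      (L.foldl (fun s v ↦ LRAState.relax I v s p) s).Qrewire = s.Qrewire := by
  induction L generalizing s with
  | nil => simpa using h
  | cons v L ih =>
    rw [List.forall_mem_cons] at hL
    rw [singleton_prod_mem_cons] at h
    obtain ⟨hinv, hT, hQ⟩ := h.relax hE hp hpt hL.1.2 hL.1.1
    obtain ⟨hfold, hQ'⟩ := ih hinv (hT ▸ hp) (hQ ▸ hL.2)
    exact ⟨hfold, hQ'.trans hQ⟩

lemma RewireInv.key_top_eq [Finite V] (hEv : IsInitial I Ev E) (h : RewireInv I Ev E ∅ s)
    (hne : s.Qrewire.Nonempty)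
    (hlt : sourceDist I (bandWeight I E) (s.top I s.Qrewire) < ∞) :
    (s.node (s.top I s.Qrewire)).key = sourceDist I (bandWeight I E) (s.top I s.Qrewire) := by
  refine (dijkstra_key_eq (isWeight_bandWeight I E) (S := {x | x ∈ s.T}) (Q := s.Qrewire)
    (key := fun x ↦ (s.node x).key) ?_ ?_ (h.le_key _) (fun q ↦ key_top_le)
    (h.tentative _ (top_mem I s hne)).1 hlt).1
  · exact fun hs ↦ absurd (h.evaluated _ hEv.source) hs
  · exact fun x hx y hy hxy ↦
      ⟨(h.cover y hxy.2.2).resolve_left hy, h.child x y hxy hx hy (Set.notMem_empty _)⟩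

lemma RewireInv.not_sourceDist_top_lt [Finite V] (hEv : IsInitial I Ev E)
    (h : RewireInv I Ev E ∅ s) (hne : s.Qrewire.Nonempty)
    (hpar : (s.node (s.top I s.Qrewire)).parent = none) :
    ¬ sourceDist I (bandWeight I E) (s.top I s.Qrewire) < ∞ := fun hlt ↦ by
  have hkey := h.key_top_eq hEv hne hlt
  rcases (h.tentative _ (top_mem I s hne)).2 with ⟨-, htop⟩ | ⟨q, hq, -⟩
  · exact hlt.ne (hkey.symm.trans htop)
  · simp [hpar] at hq

lemma RewireInv.isFinal_top [Finite V] (hEv : IsInitial I Ev E)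
    (h : RewireInv I Ev E ∅ s) (hne : s.Qrewire.Nonempty)
    (hpar : (s.node (s.top I s.Qrewire)).parent ≠ none) :
    IsFinal I (bandWeight I E) Ev (s.top I s.Qrewire) (s.node (s.top I s.Qrewire)) := by
  obtain ⟨hpT, htent⟩ := h.tentative _ (top_mem I s hne)
  have hlt : sourceDist I (bandWeight I E) (s.top I s.Qrewire) < ∞ := by
    rcases htent with ⟨hnone, -⟩ | ⟨q, -, -, hwq, hdq, hkey, -⟩
    · exact absurd hnone hpar
    · exact (h.le_key _).trans_lt (hkey ▸ ENNReal.add_lt_top.2 ⟨hdq, hwq⟩)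
  exact htent.isFinal (isWeight_bandWeight I E) (h.key_top_eq hEv hne hlt).le hlt
    fun hp ↦ hpT (h.evaluated _ hp)

lemma RewireInv.erase (h : RewireInv I Ev E ∅ s)
    (hp : ¬ sourceDist I (bandWeight I E) p < ∞) :
    RewireInv I Ev E ∅ { s with Qrewire := s.Qrewire.erase p } :=
  { h with
    tentative := fun x hx ↦ h.tentative x (Finset.mem_of_mem_erase hx)
    cover := fun x hx ↦ (h.cover x hx).imp_right fun hxQ ↦
      Finset.mem_erase.2 ⟨fun hxp ↦ hp (hxp ▸ hx), hxQ⟩ }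

lemma RewireInv.insert_T (h : RewireInv I Ev E ∅ s)
    (hp : IsFinal I (bandWeight I E) Ev p (s.node p)) {Qe Qf : Finset V}
    (hpending : ∀ x ∈ s.Qrewire.erase p, IsPred I (bandWeight I E) p x → (p, x) ∈ pending)
    (hQe : ∀ q ∈ Qe, q ∈ insert p s.T ∧ q ∉ Ev)
    (hQf : ∀ x, x ∈ Qf ↔ x = I.target ∧ x ∈ insert p s.T) :
    RewireInv I Ev E pending { s with
      T := insert p s.T
      Qrewire := s.Qrewire.erase p
      Qextend := Qe
      Qfrontier := Qf } where
  E_eq := h.E_eq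
  result := h.result
  Qupdate := h.Qupdate
  le_key := h.le_key
  final := Finset.forall_mem_insert _ _ _ |>.2 ⟨hp, h.final⟩
  tentative x hx := by
    obtain ⟨hxp, hxQ⟩ := Finset.mem_erase.1 hx
    simpa [hxp] using h.tentative x hxQ
  child q x hqx hq hx hpend := by
    have hx' : x ≠ p ∧ x ∉ s.T := by simpa using hx
    have hqp : q ≠ p := by
      rintro rfl
      exact hpend (hpending x (Finset.mem_erase.2
        ⟨hx'.1, (h.cover x hqx.2.2).resolve_left hx'.2⟩) hqx)
    exact h.child q x hqx (Finset.mem_of_mem_insert_of_ne hq hqp) hx'.2 (Set.notMem_empty _)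
  cover x hx := by
    have := h.cover x hx
    simp only [Finset.mem_insert, Finset.mem_erase]
    tauto
  evaluated x hx := Finset.mem_insert_of_mem (h.evaluated x hx)
  Qextend := hQe
  target ht := (hQf _).2 ⟨rfl, ht⟩
  frontier x hx := (hQf x).1 hx

lemma rewireBody_of_parent_eq_none (h : (s.node (s.top I s.Qrewire)).parent = none) :
    rewireBody I ⊤ s = { s with Qrewire := s.Qrewire.erase (s.top I s.Qrewire) } :=
  if_pos h

lemma rewireBody_of_top_eq (h : (s.node (s.top I s.Qrewire)).parent ≠ none)
    (ht : s.top I s.Qrewire = I.target) :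
    rewireBody I ⊤ s = { s with
      T := insert (s.top I s.Qrewire) s.T
      Qrewire := s.Qrewire.erase (s.top I s.Qrewire)
      Qextend := s.Qextend
      Qfrontier := insert (s.top I s.Qrewire) s.Qfrontier } :=
  (if_neg h).trans (if_pos (.inr ht))

lemma rewireBody_of_top_ne (h : (s.node (s.top I s.Qrewire)).parent ≠ none)
    (hb : (s.node (s.top I s.Qrewire)).b ≠ ⊤) (ht : s.top I s.Qrewire ≠ I.target) :
    rewireBody I ⊤ s =
      ((s.Qrewire.erase (s.top I s.Qrewire)).filter fun v ↦
        (s.top I s.Qrewire, v) ∈ s.E).toList.foldl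
        (fun s' v ↦ LRAState.relax I v s' (s.top I s.Qrewire))
        { s with
          T := insert (s.top I s.Qrewire) s.T
          Qrewire := s.Qrewire.erase (s.top I s.Qrewire)
          Qextend := insert (s.top I s.Qrewire) s.Qextend
          Qfrontier := s.Qfrontier } := by
  simp [rewireBody, h, ht, hb, lt_top_iff_ne_top]

lemma RewireInv.rewireBody [Finite V] (hE : E ⊆ I.edges) (hEv : IsInitial I Ev E)
    (h : RewireInv I Ev E ∅ s) (hne : s.Qrewire.Nonempty) :
    RewireInv I Ev E ∅ (rewireBody I ⊤ s) ∧
      (rewireBody I ⊤ s).Qrewire = s.Qrewire.erase (s.top I s.Qrewire) := by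
  by_cases hpar : (s.node (s.top I s.Qrewire)).parent = none
  · rw [rewireBody_of_parent_eq_none hpar]
    exact ⟨h.erase (h.not_sourceDist_top_lt hEv hne hpar), rfl⟩
  have hfinal := h.isFinal_top hEv hne hpar
  have hpEv := fun hp ↦ (h.tentative _ (top_mem I s hne)).1 (h.evaluated _ hp)
  have hQf : ∀ x, x ∈ s.Qfrontier ↔ x = I.target ∧ x ∈ s.T := fun x ↦
    ⟨h.frontier x, fun ⟨hx, hxT⟩ ↦ hx ▸ h.target (hx ▸ hxT)⟩
  by_cases hpt : s.top I s.Qrewire = I.target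
  · rw [rewireBody_of_top_eq hpar hpt]
    refine ⟨h.insert_T hfinal (fun x _ hpx ↦ absurd hpt hpx.mem_and_ne_target.2)
      (fun q hq ↦ ⟨Finset.mem_insert_of_mem (h.Qextend q hq).1, (h.Qextend q hq).2⟩) ?_, rfl⟩
    grind
  · rw [rewireBody_of_top_ne hpar hfinal.b_ne_top hpt]
    refine (h.insert_T hfinal (fun x hx hpx ↦ ?_) ?_ ?_).foldl_relax hE
      (Finset.mem_insert_self _ _) hpt (by simp [h.E_eq])
    · simpa [h.E_eq, hpx.mem_and_ne_target.1] using hx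
    · exact (Finset.forall_mem_insert _ _ _).2 ⟨⟨Finset.mem_insert_self _ _, hpEv⟩,
        fun q hq ↦ ⟨Finset.mem_insert_of_mem (h.Qextend q hq).1, (h.Qextend q hq).2⟩⟩
    · grind

lemma RewireInv.extendInv (hEv : IsInitial I Ev E) (h : RewireInv I Ev E ∅ s)
    (hQ : s.Qrewire = ∅) : ExtendInv I Ev E ∅ { s with Trewire := ∅ } where
  quiet := ⟨h.E_eq, h.result, h.Qupdate, hQ, rfl⟩
  le_key := h.le_key
  key_lt x hx := (h.final x hx).key ▸ (h.final x hx).lt_top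
  subset q hq := (h.Qextend q hq).1
  child _ x hqx _ _ _ :=
    have hx := (h.cover x hqx.2.2).resolve_right (by simp [hQ])
    ⟨hx, h.final x hx⟩
  final x hx _ := h.final x hx
  evaluated x hx := ⟨h.evaluated x hx, h.final x (h.evaluated x hx)⟩
  notMem_evaluated q hq _ hqx hx := (h.Qextend q hq).2 (hEv.closed _ _ hqx hx)
  target ht := .inr (h.target ht)
  frontier := h.frontier

lemma RewireInv.extendInv_whileLoop [Finite V] (hE : E ⊆ I.edges) (hEv : IsInitial I Ev E)
    (h : RewireInv I Ev E ∅ s) :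
    ExtendInv I Ev E ∅
      { whileLoop (fun s ↦ s.Qrewire.Nonempty) (LRAState.rewireBody I ⊤) s with
        Trewire := ∅ } := by
  obtain ⟨hinv, hQ⟩ := whileLoop_induction (cond := fun s ↦ s.Qrewire.Nonempty)
    (body := LRAState.rewireBody I ⊤) (RewireInv I Ev E ∅) (fun s ↦ s.Qrewire.card)
    (fun s hs hne ↦ (hs.rewireBody hE hEv hne).imp_right fun hQ ↦
      (congrArg Finset.card hQ).trans_lt (Finset.card_erase_lt_of_mem (top_mem I s hne))) h
  exact hinv.extendInv hEv (Finset.not_nonempty_iff_eq_empty.1 hQ)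

end Rewire

end LRAState

section Erase

variable {V : Type u} [DecidableEq V] {I : Input V} {Ev : Set V} {E : Finset (V × V)}
  {e f : V × V} {p x : V} {t : Entry V}

lemma bandWeight_erase_le (e f : V × V) : bandWeight I E f ≤ bandWeight I (E.erase e) f := by
  unfold bandWeight
  split_ifs <;> simp_all

lemma bandWeight_erase_of_ne (h : f ≠ e) : bandWeight I (E.erase e) f = bandWeight I E f := by
  simp [bandWeight, h]

lemma bandWeight_erase_of_not_isAncestor (hx : ¬ IsAncestor I (bandWeight I E) e.2 x) (q y : V)
    (hy : IsAncestor I (bandWeight I E) y x) :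
    bandWeight I (E.erase e) (q, y) = bandWeight I E (q, y) :=
  bandWeight_erase_of_ne (by rintro rfl; exact hx hy)

lemma sourceDist_erase [Finite V] (hx : ¬ IsAncestor I (bandWeight I E) e.2 x)
    (hlt : sourceDist I (bandWeight I E) x < ∞) :
    sourceDist I (bandWeight I (E.erase e)) x = sourceDist I (bandWeight I E) x :=
  sourceDist_eq_of_le (fun f _ ↦ bandWeight_erase_le e f)
    (fun q y _ ↦ bandWeight_erase_of_not_isAncestor hx q y) hlt

lemma isPred_erase_iff [Finite V] (hx : ¬ IsAncestor I (bandWeight I E) e.2 x)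
    (hlt : sourceDist I (bandWeight I E) x < ∞) :
    IsPred I (bandWeight I (E.erase e)) p x ↔ IsPred I (bandWeight I E) p x :=
  isPred_iff_of_le (isWeight_bandWeight I _) (fun f _ ↦ bandWeight_erase_le e f)
    (fun q y _ ↦ bandWeight_erase_of_not_isAncestor hx q y) hlt

lemma IsFinal.erase [Finite V] (hx : ¬ IsAncestor I (bandWeight I E) e.2 x)
    (h : IsFinal I (bandWeight I E) Ev x t) : IsFinal I (bandWeight I (E.erase e)) Ev x t where
  parent p := (h.parent p).trans (isPred_erase_iff hx h.lt_top).symm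
  key := h.key.trans (sourceDist_erase hx h.lt_top).symm
  lt_top := sourceDist_erase hx h.lt_top ▸ h.lt_top
  b_ne_top := h.b_ne_top
  b_eq_zero := h.b_eq_zero
  l_eq_zero := h.l_eq_zero

lemma LRAState.IsInitial.erase [Finite V] (hEv : IsInitial I Ev E)
    (hEvd : ∀ x ∈ Ev, sourceDist I (bandWeight I E) x < ∞) (he : e.2 ∉ Ev) :
    IsInitial I Ev (E.erase e) :=
  ⟨hEv.source, fun p x h hx ↦ hEv.closed p x ((isPred_erase_iff
    (fun hex ↦ he (hEv.mem_of_isAncestor hex hx)) (hEvd x hx)).1 h) hx⟩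

end Erase

namespace LRAState

section Reset

variable {V : Type u} [DecidableEq V] (I : Input V) (Ev : Set V) (E : Finset (V × V))

/-- The invariant of the first loop of `rewireBand` for lookahead `⊤`. The vertices in `pending`
have not been reset yet. -/
structure ResetInv (pending : Set V) (s : LRAState V) : Prop where
  E_eq : s.E = E
  result : s.result = none
  Qupdate : s.Qupdate = ∅
  Qextend : s.Qextend = ∅
  Qfrontier : s.Qfrontier = ∅
  le_key : ∀ x ∉ s.T, sourceDist I (bandWeight I E) x ≤ (s.node x).key
  final : ∀ x ∈ s.T, x ∉ s.Trewire → IsFinal I (bandWeight I E) Ev x (s.node x)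
  tentative : ∀ x ∈ s.Qrewire, x ∉ s.T ∧ IsTentative I (bandWeight I E) x (s.node x)
  child : ∀ q x, IsPred I (bandWeight I E) q x → q ∈ s.T → q ∉ s.Trewire → x ∉ s.T →
    (s.node x).key ≤ sourceDist I (bandWeight I E) x
  cover : ∀ x, sourceDist I (bandWeight I E) x < ∞ → x ∈ s.T ∨ x ∈ s.Qrewire
  evaluated : ∀ x ∈ Ev, x ∈ s.T ∧ x ∉ s.Trewire
  target : I.target ∈ s.T → I.target ∈ s.Trewire
  pending : ∀ x ∈ s.T, x ∈ s.Trewire → x ∈ pending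

variable {I Ev E} {pending : Set V} {s : LRAState V} {v : V}

lemma exists_foldl_relax_eq (hE : E ⊆ I.edges) {L : List V}
    (hL : ∀ q ∈ L, q ≠ v ∧ IsFinal I (bandWeight I E) Ev q (s.node q) ∧ (q, v) ∈ E ∧ q ≠ I.target)
    (hv : IsTentative I (bandWeight I E) v (s.node v)) :
    ∃ t, L.foldl (relax I v) s = { s with node := Function.update s.node v t } ∧
      IsTentative I (bandWeight I E) v t ∧ t.key ≤ (s.node v).key ∧
      ∀ q ∈ L, t.key ≤ sourceDist I (bandWeight I E) q + bandWeight I E (q, v) := by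
  induction L generalizing s with
  | nil => exact ⟨s.node v, by simp, hv, le_rfl, by simp⟩
  | cons q L ih =>
    rw [List.forall_mem_cons] at hL
    obtain ⟨⟨-, hq, hqv, hqt⟩, hL⟩ := hL
    obtain ⟨t, heq, ht, hle, hleq⟩ := exists_relax_eq hE hq hqv hqt hv
    obtain ⟨t', heq', ht', hle', hleL⟩ := ih (s := { s with node := Function.update s.node v t })
      (fun q hq ↦ ⟨(hL q hq).1, by simpa [(hL q hq).1] using (hL q hq).2⟩) (by simpa using ht)
    simp only [Function.update_self, Function.update_idem] at hle' heq'
    refine ⟨t', by rw [List.foldl_cons, heq, heq'], ht', hle'.trans hle, ?_⟩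
    exact List.forall_mem_cons.2 ⟨hle'.trans hleq, hleL⟩

lemma ResetInv.exists_rewireReset_eq (hE : E ⊆ I.edges)
    (h : ResetInv I Ev E pending s) (hv : v ∈ s.Trewire) :
    ∃ t, rewireReset I ⊤ s v = { s with
        node := Function.update s.node v t
        T := s.T.erase v
        Qfrontier := s.Qfrontier.erase v
        Qrewire := insert v s.Qrewire } ∧
      IsTentative I (bandWeight I E) v t ∧
      ∀ q ∈ s.T, q ∉ s.Trewire → IsPred I (bandWeight I E) q v →
        t.key ≤ sourceDist I (bandWeight I E) v := by
  set s₁ : LRAState V :=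
    { s.setNode v Entry.unset with T := s.T.erase v, Qfrontier := s.Qfrontier.erase v } with hs₁
  set parents := s₁.T.filter fun p ↦ (p, v) ∈ s₁.E ∧ (s₁.node p).b < ⊤ ∧
    p ∉ s₁.Trewire ∧ p ∉ s₁.Qextend ∧ p ≠ I.target with hparents
  have hnode : ∀ q, q ∉ s.Trewire → s₁.node q = s.node q := fun q hq ↦
    Function.update_of_ne (by rintro rfl; exact hq hv) _ _
  have hfinal : ∀ q ∈ parents.toList, q ≠ v ∧
      IsFinal I (bandWeight I E) Ev q (s₁.node q) ∧ (q, v) ∈ E ∧ q ≠ I.target := by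
    intro q hq
    obtain ⟨hqT, hqv, -, hqR, -, hqt⟩ := Finset.mem_filter.1 (Finset.mem_toList.1 hq)
    exact ⟨Finset.ne_of_mem_erase hqT,
      hnode q hqR ▸ h.final q (Finset.mem_of_mem_erase hqT) hqR, h.E_eq ▸ hqv, hqt⟩
  obtain ⟨t, heq, ht, -, hle⟩ := exists_foldl_relax_eq hE hfinal
    (.inl (by simp [hs₁, setNode, Entry.unset, Entry.key]))
  refine ⟨t, ?_, ht, fun q hqT hqR hqv ↦ hqv.2.1 ▸ hle q ?_⟩
  · change { parents.toList.foldl (relax I v) s₁ with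
      Qrewire := insert v (parents.toList.foldl (relax I v) s₁).Qrewire } = _
    rw [heq]
    simp [hs₁, setNode]
  · have hne : q ≠ v := by rintro rfl; exact hqR hv
    simp only [hparents, Finset.mem_toList, Finset.mem_filter, hnode q hqR, lt_top_iff_ne_top]
    exact ⟨Finset.mem_erase.2 ⟨hne, hqT⟩, h.E_eq ▸ hqv.mem_and_ne_target.1,
      (h.final q hqT hqR).b_ne_top, hqR, h.Qextend ▸ Finset.notMem_empty q,
      hqv.mem_and_ne_target.2⟩

lemma ResetInv.rewireReset [Finite V] (hE : E ⊆ I.edges)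
    (h : ResetInv I Ev E (insert v pending) s) (hv : v ∈ s.Trewire) :
    ResetInv I Ev E pending (rewireReset I ⊤ s v) ∧
      (rewireReset I ⊤ s v).Trewire = s.Trewire := by
  obtain ⟨t, heq, ht, hle⟩ := h.exists_rewireReset_eq hE hv
  rw [heq]
  have hne : ∀ {x}, x ∉ s.Trewire → x ≠ v := by rintro x hx rfl; exact hx hv
  refine ⟨{ h with
    Qfrontier := by simp [h.Qfrontier], le_key := ?_, final := ?_, tentative := ?_, child := ?_,
    cover := ?_, evaluated := ?_, target := ?_, pending := ?_ }, rfl⟩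
  · refine (Function.forall_update_iff s.node fun x t ↦
      x ∉ s.T.erase v → sourceDist I (bandWeight I E) x ≤ t.key).2
      ⟨fun _ ↦ ht.sourceDist_le, fun x hxv hx ↦ h.le_key x (by simpa [hxv] using hx)⟩
  · intro x hx hxR
    simpa [hne hxR] using h.final x (Finset.mem_of_mem_erase hx) hxR
  · refine (Function.forall_update_iff s.node fun x t ↦
      x ∈ insert v s.Qrewire → x ∉ s.T.erase v ∧ IsTentative I (bandWeight I E) x t).2
      ⟨fun _ ↦ ⟨by simp, ht⟩, fun x hxv hx ↦ ?_⟩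
    simpa [hxv] using h.tentative x (Finset.mem_of_mem_insert_of_ne hx hxv)
  · intro q x hqx hq hqR
    have hqT := Finset.mem_of_mem_erase hq
    rcases eq_or_ne x v with rfl | hxv
    · simpa using hle q hqT hqR hqx
    · simpa [hxv] using h.child q x hqx hqT hqR
  · intro x hx
    have := h.cover x hx
    simp only [Finset.mem_erase, Finset.mem_insert]
    tauto
  · exact fun x hx ↦ ⟨Finset.mem_erase.2 ⟨hne (h.evaluated x hx).2, (h.evaluated x hx).1⟩,
      (h.evaluated x hx).2⟩
  · exact fun ht ↦ h.target (Finset.mem_of_mem_erase ht)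
  · intro x hx hxR
    exact (h.pending x (Finset.mem_of_mem_erase hx) hxR).resolve_left (Finset.ne_of_mem_erase hx)

lemma ResetInv.foldl_rewireReset [Finite V] (hE : E ⊆ I.edges) {L : List V}
    (h : ResetInv I Ev E {x | x ∈ L} s) (hL : ∀ v ∈ L, v ∈ s.Trewire) :
    ResetInv I Ev E ∅ (L.foldl (LRAState.rewireReset I ⊤) s) := by
  induction L generalizing s with
  | nil => simpa using h
  | cons v L ih =>
    rw [List.forall_mem_cons] at hL
    rw [List.setOfPred_mem_cons] at h
    obtain ⟨hinv, hR⟩ := h.rewireReset hE hL.1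
    exact ih hinv (hR ▸ hL.2)

lemma ResetInv.rewireInv (h : ResetInv I Ev E ∅ s) : RewireInv I Ev E ∅ s := by
  have hfinal : ∀ x ∈ s.T, IsFinal I (bandWeight I E) Ev x (s.node x) := fun x hx ↦
    h.final x hx (h.pending x hx)
  exact {
    E_eq := h.E_eq
    result := h.result
    Qupdate := h.Qupdate
    le_key x := if hx : x ∈ s.T then (hfinal x hx).key.ge else h.le_key x hx
    final := hfinal
    tentative := h.tentative
    child q x hqx hq hx _ := h.child q x hqx hq (h.pending q hq) hx
    cover := h.cover
    evaluated x hx := (h.evaluated x hx).1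
    Qextend := by simp [h.Qextend]
    target ht := absurd (h.target ht) (h.pending _ ht)
    frontier := by simp [h.Qfrontier] }

lemma Stable.mem_subtree_iff (h : Stable I Ev E s) {x : V} (hx : x ∈ s.T) :
    x ∈ s.subtree v ↔ IsAncestor I (bandWeight I E) v x := by
  have hfinal : ∀ y, IsAncestor I (bandWeight I E) y x →
      IsFinal I (bandWeight I E) Ev y (s.node y) := fun y hy ↦
    h.final y ((h.mem_T y).2 (hy.sourceDist_le.trans_lt ((h.mem_T x).1 hx)))
  refine ⟨fun hxv ↦ isAncestor_of_parent hfinal (mem_subtree.1 hxv).2,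
    fun hvx ↦ mem_subtree.2 ⟨hx, ?_⟩⟩
  induction hvx using Relation.ReflTransGen.head_induction_on with
  | refl => exact .refl
  | head hbc hcx ih => exact ih.tail (((hfinal _ hcx).parent _).2 hbc)

lemma Stable.resetInv [Finite V] (hEv : IsInitial I Ev E)
    (hEvd : ∀ x ∈ Ev, sourceDist I (bandWeight I E) x < ∞) (h : Stable I Ev E s) {e : V × V}
    (he : e.2 ∉ Ev) (het : IsAncestor I (bandWeight I E) e.2 I.target) :
    ResetInv I Ev (E.erase e) (s.subtree e.2)
      { s with Qfrontier := ∅, E := E.erase e, Trewire := s.subtree e.2 } := by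
  have hT : ∀ x, sourceDist I (bandWeight I (E.erase e)) x < ∞ → x ∈ s.T := fun x hx ↦
    (h.mem_T x).2 ((sourceDist_mono (fun f _ ↦ bandWeight_erase_le e f) x).trans_lt hx)
  exact {
    E_eq := rfl
    result := h.quiet.result
    Qupdate := h.quiet.Qupdate
    Qextend := h.Qextend
    Qfrontier := rfl
    le_key x hx := le_top.trans
      ((not_lt.1 fun hlt ↦ hx ((h.mem_T x).2 hlt) : ∞ ≤ _).trans (h.le_key x))
    final x hx hxR := (h.final x hx).erase fun hex ↦ hxR ((h.mem_subtree_iff hx).2 hex)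
    tentative := by simp [h.quiet.Qrewire]
    child q x hqx _ _ hx := absurd (hT x hqx.2.2) hx
    cover x hx := .inl (hT x hx)
    evaluated x hx := by
      have hxT := (h.mem_T x).2 (hEvd x hx)
      exact ⟨hxT, fun hxR ↦ he (hEv.mem_of_isAncestor ((h.mem_subtree_iff hxT).1 hxR) hx)⟩
    target ht := (h.mem_subtree_iff ht).2 het
    pending _ _ hx := hx }

lemma Stable.extendInv_rewireBand [Finite V] (hE : E ⊆ I.edges) (hEv : IsInitial I Ev E)
    (hEvd : ∀ x ∈ Ev, sourceDist I (bandWeight I E) x < ∞) (h : Stable I Ev E s) {e : V × V}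
    (he : e.2 ∉ Ev) (het : IsAncestor I (bandWeight I E) e.2 I.target) :
    ExtendInv I Ev (E.erase e) ∅ (rewireBand I ⊤
      { s with Qfrontier := ∅, E := E.erase e, Trewire := s.subtree e.2 }) := by
  have hE' : E.erase e ⊆ I.edges := (Finset.erase_subset _ _).trans hE
  have hreset := h.resetInv hEv hEvd he het
  have hfold := ResetInv.foldl_rewireReset (L := (s.subtree e.2).toList) hE'
    (by simpa using hreset) (by simp)
  exact hfold.rewireInv.extendInv_whileLoop hE' (hEv.erase hEvd he)

end Reset

end LRAState

/-! ### LRA* with infinite lookahead performs the actions of LazySP -/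

namespace LRAState

section Reflects

variable {V : Type u} [DecidableEq V] (I : Input V) (known : V × V → Option ℝ≥0∞)
  (E : Finset (V × V)) (Ev : Set V)

/-- The remaining edges `E` of LRA* and the vertices `Ev` to which the path in its search tree is
evaluated reflect the values that LazySP has recorded. -/
structure Reflects : Prop where
  isWeight : IsWeight I (currentWeight I known)
  subset : E ⊆ I.edges
  mem_iff : ∀ e ∈ I.edges, e ∈ E ↔ known e ≠ some ∞
  isInitial : IsInitial I Ev E
  lt_top : ∀ x ∈ Ev, sourceDist I (bandWeight I E) x < ∞
  le_target : ∀ x ∈ Ev, sourceDist I (bandWeight I E) x ≤ sourceDist I (bandWeight I E) I.target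
  mem_of_known : ∀ e ∈ E, known e ≠ none → e.2 ∈ Ev
  known_of_mem : ∀ p x, IsPred I (bandWeight I E) p x → x ∈ Ev → known (p, x) ≠ none

variable {I known E Ev} {e : V × V} {x : V} {P Q : List V}

lemma reflects_none : Reflects I (fun _ ↦ none) I.edges {I.source} where
  isWeight e _ := Or.inl (currentWeight_of_eq_none rfl)
  subset := subset_rfl
  mem_iff e he := by simpa using he
  isInitial := isInitial_singleton
  lt_top := by simp
  le_target := by simp
  mem_of_known e _ h := absurd rfl h
  known_of_mem := by
    rintro p x h rfl
    exact absurd h (not_isPred_source (isWeight_bandWeight I _) p)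

lemma Reflects.bandWeight_eq (h : Reflects I known E Ev) (he : e ∈ I.edges)
    (het : e.1 ≠ I.target) : bandWeight I E e = currentWeight I known e := by
  by_cases hE : e ∈ E
  · have hlt : currentWeight I known e < ∞ := by
      have := (h.mem_iff e he).1 hE
      cases hk : known e <;> simp_all [currentWeight, lt_top_iff_ne_top]
    simp [h.isWeight.eq_lazyW he hlt, bandWeight, hE, het]
  · have hk : known e = some ∞ := not_not.1 (mt (h.mem_iff e he).2 hE)
    simp [bandWeight, hE, currentWeight, hk]

lemma Reflects.currentWeight_le (h : Reflects I known E Ev) (he : e ∈ I.edges) :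
    currentWeight I known e ≤ bandWeight I E e := by
  by_cases het : e.1 = I.target
  · simp [bandWeight, het]
  · exact (h.bandWeight_eq he het).ge

lemma Reflects.min_sourceDist_le_cost (h : Reflects I known E Ev)
    (hQ : IsPath I.edges I.source x Q) :
    min (sourceDist I (bandWeight I E) x) (sourceDist I (bandWeight I E) I.target) ≤
      cost (currentWeight I known) Q := by
  cases hfind : (pathEdges Q).find? fun e ↦ decide (e.1 = I.target) with
  | none =>
    refine (min_le_left _ _).trans ((sourceDist_le_cost hQ).trans (cost_mono fun e he ↦ ?_))
    exact (h.bandWeight_eq (hQ.mem_of_mem_pathEdges he)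
      (by simpa using List.find?_eq_none.1 hfind e he)).le
  | some e =>
    obtain ⟨het, L, M, hsplit, hL⟩ := List.find?_eq_some_iff_append.1 hfind
    obtain ⟨A, B, rfl, rfl⟩ := exists_append_of_pathEdges_eq hsplit
    rw [decide_eq_true_eq] at het
    have hA := (isPath_append_cons.1 hQ).1
    rw [cost_append_cons, ← het]
    refine (min_le_right _ _).trans (le_add_right ((sourceDist_le_cost hA).trans
      (cost_mono fun f hf ↦ ?_)))
    exact (h.bandWeight_eq (hA.mem_of_mem_pathEdges hf) (by simpa using hL f hf)).le

lemma Reflects.isShortestPath (h : Reflects I known E Ev)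
    (hP : IsShortestPath I (bandWeight I E) x P)
    (hx : sourceDist I (bandWeight I E) x ≤ sourceDist I (bandWeight I E) I.target) :
    IsShortestPath I (currentWeight I known) x P := by
  have hle : cost (currentWeight I known) P ≤ sourceDist I (bandWeight I E) x :=
    hP.cost_eq ▸ cost_mono fun e he ↦ h.currentWeight_le (hP.1.mem_of_mem_pathEdges he)
  refine ⟨hP.1, hle.trans_lt hP.sourceDist_lt_top, fun Q hQ ↦ hle.trans ?_⟩
  simpa [min_eq_left hx] using h.min_sourceDist_le_cost hQ

lemma Reflects.known_ne_none_iff (h : Reflects I known E Ev)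
    (he : IsPred I (bandWeight I E) e.1 e.2) : known e ≠ none ↔ e.2 ∈ Ev :=
  ⟨h.mem_of_known e he.mem_and_ne_target.1, h.known_of_mem e.1 e.2 he⟩

lemma Reflects.mem_iff_forall_known (h : Reflects I known E Ev)
    (hP : IsShortestPath I (bandWeight I E) x P) :
    x ∈ Ev ↔ ∀ e ∈ pathEdges P, known e ≠ none := by
  refine ⟨fun hx e he ↦ (h.known_ne_none_iff (hP.isPred he)).2 ?_, fun hknown ↦ ?_⟩
  · exact h.isInitial.mem_of_isAncestor (hP.isAncestor (snd_mem_of_mem_pathEdges he)) hx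
  · rcases hP.eq_singleton_or_exists with ⟨rfl, -⟩ | ⟨p, Q, hpx, hQ, rfl⟩
    · exact h.isInitial.source
    · obtain ⟨A, rfl⟩ := hQ.1.exists_eq_append
      refine (h.known_ne_none_iff (e := (p, x)) hpx).1 (hknown _ ?_)
      rw [List.append_assoc, List.singleton_append, pathEdges_append_cons]
      simp

lemma Reflects.lazySPAction_of_target_mem (h : Reflects I known E Ev)
    (hP : IsShortestPath I (bandWeight I E) I.target P) (ht : I.target ∈ Ev) :
    lazySPAction I known = .report (some P) := by
  have hnone : (pathEdges P).find? (fun e ↦ (known e).isNone) = none :=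
    List.find?_eq_none.2 (by simpa [Option.isNone_iff_eq_none] using
      (h.mem_iff_forall_known hP).1 ht)
  rw [lazySPAction_of_isShortestPath h.isWeight (h.isShortestPath hP le_rfl), hnone]
  rfl

lemma Reflects.lazySPAction_of_sourceDist_eq_top (h : Reflects I known E Ev)
    (ht : sourceDist I (bandWeight I E) I.target = ∞) :
    lazySPAction I known = .report none := by
  refine lazySPAction_of_not_exists fun ⟨P, hP⟩ ↦ hP.2.1.not_ge ?_
  simpa [ht] using h.min_sourceDist_le_cost hP.1

variable (I E Ev) in
/-- The edge `e` is the first edge of the unevaluated part of the path to the target in the search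
tree. -/
structure IsNext (e : V × V) : Prop where
  isPred : IsPred I (bandWeight I E) e.1 e.2
  isAncestor : IsAncestor I (bandWeight I E) e.2 I.target
  fst_mem : e.1 ∈ Ev
  snd_notMem : e.2 ∉ Ev

lemma Reflects.exists_isNext (h : Reflects I known E Ev)
    (hP : IsShortestPath I (bandWeight I E) I.target P) (ht : I.target ∉ Ev) :
    ∃ e, (pathEdges P).find? (fun e ↦ (known e).isNone) = some e ∧ IsNext I E Ev e := by
  cases hfind : (pathEdges P).find? fun e ↦ (known e).isNone with
  | none =>
    refine absurd ((h.mem_iff_forall_known hP).2 ?_) ht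
    simpa [Option.isNone_iff_eq_none] using hfind
  | some e =>
    obtain ⟨he, L, M, hsplit, hL⟩ := List.find?_eq_some_iff_append.1 hfind
    have hmem : e ∈ pathEdges P := by simp [hsplit]
    obtain ⟨A, B, rfl, rfl⟩ := exists_append_of_pathEdges_eq hsplit
    refine ⟨e, rfl, hP.isPred hmem, hP.isAncestor (snd_mem_of_mem_pathEdges hmem),
      (h.mem_iff_forall_known hP.initialPart).2 fun f hf ↦
        Option.isSome_iff_ne_none.1 (by simpa using hL f hf), ?_⟩
    rw [← h.known_ne_none_iff (hP.isPred hmem), not_not]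
    exact Option.isNone_iff_eq_none.1 he

lemma Reflects.erase [Finite V] (h : Reflects I known E Ev) (he : e ∈ I.edges)
    (hev : e.2 ∉ Ev) : Reflects I (Function.update known e (some ∞)) (E.erase e) Ev := by
  have hanc : ∀ x ∈ Ev, ¬ IsAncestor I (bandWeight I E) e.2 x :=
    fun x hx hex ↦ hev (h.isInitial.mem_of_isAncestor hex hx)
  have hdist : ∀ x ∈ Ev, sourceDist I (bandWeight I (E.erase e)) x =
      sourceDist I (bandWeight I E) x := fun x hx ↦ sourceDist_erase (hanc x hx) (h.lt_top x hx)
  constructor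
  case isWeight =>
    intro f hf
    rcases eq_or_ne f e with rfl | hfe
    · simp [currentWeight]
    · simpa [currentWeight, hfe] using h.isWeight f hf
  case subset => exact (Finset.erase_subset _ _).trans h.subset
  case mem_iff =>
    intro f hf
    rcases eq_or_ne f e with rfl | hfe
    · simp
    · simpa [hfe] using h.mem_iff f hf
  case isInitial => exact h.isInitial.erase h.lt_top hev
  case lt_top => exact fun x hx ↦ hdist x hx ▸ h.lt_top x hx
  case le_target =>
    intro x hx
    rw [hdist x hx]
    exact (h.le_target x hx).trans (sourceDist_mono (fun f _ ↦ bandWeight_erase_le e f) _)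
  case mem_of_known =>
    intro f hf hk
    rw [Finset.mem_erase] at hf
    exact h.mem_of_known f hf.2 (by rwa [Function.update_of_ne hf.1] at hk)
  case known_of_mem =>
    intro p x hpx hx
    rw [isPred_erase_iff (hanc x hx) (h.lt_top x hx)] at hpx
    rw [Function.update_of_ne (by rintro rfl; exact hev hx)]
    exact h.known_of_mem p x hpx hx

lemma Reflects.insert [Finite V] (h : Reflects I known E Ev) (he : IsNext I E Ev e) :
    Reflects I (Function.update known e (some (I.lazyW e : ℝ≥0∞))) E (insert e.2 Ev) := by
  have hw := isWeight_bandWeight I E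
  constructor
  case isWeight =>
    intro f hf
    rcases eq_or_ne f e with rfl | hfe
    · simp [currentWeight]
    · simpa [currentWeight, hfe] using h.isWeight f hf
  case subset => exact h.subset
  case mem_iff =>
    intro f hf
    rcases eq_or_ne f e with rfl | hfe
    · simpa using he.isPred.mem_and_ne_target.1
    · simpa [hfe] using h.mem_iff f hf
  case isInitial =>
    refine ⟨Or.inr h.isInitial.source, fun p x hpx hx ↦ Or.inr ?_⟩
    rcases hx with rfl | hx
    · exact hpx.unique hw he.isPred ▸ he.fst_mem
    · exact h.isInitial.closed p x hpx hx
  case lt_top => exact Set.forall_mem_insert.2 ⟨he.isPred.2.2, h.lt_top⟩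
  case le_target => exact Set.forall_mem_insert.2 ⟨he.isAncestor.sourceDist_le, h.le_target⟩
  case mem_of_known =>
    intro f hf hk
    rcases eq_or_ne f e with rfl | hfe
    · exact Or.inl rfl
    · exact Or.inr (h.mem_of_known f hf (by rwa [Function.update_of_ne hfe] at hk))
  case known_of_mem =>
    intro p x hpx hx
    rcases eq_or_ne (p, x) e with hpe | hpe
    · simp [hpe]
    · rw [Function.update_of_ne hpe]
      refine h.known_of_mem p x hpx (hx.resolve_left ?_)
      rintro rfl
      exact hpe (congrArg (·, e.2) (hpx.unique hw he.isPred))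

end Reflects

end LRAState

section EvaluatedEntries

variable {V : Type u} {I : Input V} {w : V × V → ℝ≥0∞} {Ev : Set V} {p v x : V} {t : Entry V}

lemma IsPred.isFinal_insert [Finite V] (hw : IsWeight I w) (h : IsPred I w p v)
    (ht : IsFinal I w Ev p t) (hp : p ∈ Ev) :
    IsFinal I w (insert v Ev) v ⟨some p, t.c + I.lazyW (p, v), 0, 0⟩ where
  parent q := by
    refine ⟨?_, fun hq ↦ congrArg some (h.unique hw hq)⟩
    rintro ⟨rfl⟩
    exact h
  key := by
    have hc : t.c = sourceDist I w p := by
      rw [← ht.key, Entry.key, ht.l_eq_zero (ht.b_eq_zero.2 hp), add_zero]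
    simp only [Entry.key, hc, add_zero, h.2.1, ← hw.eq_lazyW h.1 h.weight_lt_top]
  lt_top := h.2.2
  b_ne_top := by simp
  b_eq_zero := by simp
  l_eq_zero _ := rfl

lemma IsFinal.insert_of_ne (h : IsFinal I w Ev x t) (hxv : x ≠ v) :
    IsFinal I w (insert v Ev) x t :=
  { h with b_eq_zero := by simp [h.b_eq_zero, hxv] }

end EvaluatedEntries

namespace LRAState

section SearchTree

variable {V : Type u} {I : Input V} {w : V × V → ℝ≥0∞} {Ev : Set V} {s : LRAState V} {x : V}
  {P : List V}

lemma backtrack_eq (hw : IsWeight I w) (hP : IsShortestPath I w x P)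
    (hfinal : ∀ y ∈ P, IsFinal I w Ev y (s.node y)) {n : ℕ} (hn : P.length ≤ n + 1) :
    s.backtrack n x = P := by
  induction n generalizing x P with
  | zero =>
    rcases hP.eq_singleton_or_exists with ⟨rfl, rfl⟩ | ⟨p, Q, -, hQ, rfl⟩
    · rfl
    · exact absurd hn (by simpa using hQ.1.ne_nil)
  | succ n ih =>
    rcases hP.eq_singleton_or_exists with ⟨rfl, rfl⟩ | ⟨p, Q, hpx, hQ, rfl⟩
    · have hparent : (s.node I.source).parent = none :=
        Option.eq_none_iff_forall_ne_some.2 fun p hp ↦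
          not_isPred_source hw p (((hfinal I.source (by simp)).parent p).1 hp)
      simp [backtrack, hparent]
    · have hparent : (s.node x).parent = some p := ((hfinal x (by simp)).parent p).2 hpx
      have hpath := ih hQ (fun y hy ↦ hfinal y (List.mem_append_left _ hy)) (by simpa using hn)
      simp [backtrack, hparent, hpath]

variable [DecidableEq V] {E : Finset (V × V)} {known : V × V → Option ℝ≥0∞} {e : V × V}

variable (I Ev E) in
/-- The search tree is the complete shortest-path tree. -/
structure IsSearchTree (s : LRAState V) : Prop where
  mem_T : ∀ x, x ∈ s.T ↔ sourceDist I (bandWeight I E) x < ∞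
  final : ∀ x ∈ s.T, IsFinal I (bandWeight I E) Ev x (s.node x)

lemma Stable.isSearchTree (h : Stable I Ev E s) : IsSearchTree I Ev E s :=
  ⟨h.mem_T, h.final⟩

lemma IsSearchTree.isFinal (h : IsSearchTree I Ev E s)
    (hx : sourceDist I (bandWeight I E) x < ∞) : IsFinal I (bandWeight I E) Ev x (s.node x) :=
  h.final x ((h.mem_T x).2 hx)

lemma IsSearchTree.pathTo [Fintype V] (h : IsSearchTree I Ev E s)
    (hP : IsShortestPath I (bandWeight I E) x P) : s.pathTo x = P :=
  backtrack_eq (isWeight_bandWeight I E) hP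
    (fun _ hy ↦ h.isFinal ((hP.isAncestor hy).sourceDist_le.trans_lt hP.sourceDist_lt_top))
    ((hP.nodup (isWeight_bandWeight I E)).length_le_card.trans (Nat.le_succ _))

/-- The part of the search tree to which the paths are completely evaluated: the shortest-path tree
that LRA* builds. -/
def evaluatedTree (s : LRAState V) : Tree V where
  verts := {x | x ∈ s.T ∧ (s.node x).b = 0}
  parent x := (s.node x).parent

lemma IsSearchTree.mem_evaluatedTree_iff (h : IsSearchTree I Ev E s)
    (hEvd : ∀ x ∈ Ev, sourceDist I (bandWeight I E) x < ∞) :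
    x ∈ s.evaluatedTree.verts ↔ x ∈ Ev :=
  ⟨fun hx ↦ (h.final x hx.1).b_eq_zero.1 hx.2, fun hx ↦
    have hxT := (h.mem_T x).2 (hEvd x hx)
    ⟨hxT, (h.final x hxT).b_eq_zero.2 hx⟩⟩

lemma IsSearchTree.isShortestPathTree_evaluatedTree [Finite V] (h : IsSearchTree I Ev E s)
    (hR : Reflects I known E Ev) (hk : Agrees I w known) (hw : IsWeight I w) :
    IsShortestPathTree I w s.evaluatedTree := by
  have hmem : ∀ {x}, x ∈ s.evaluatedTree.verts ↔ x ∈ Ev := h.mem_evaluatedTree_iff hR.lt_top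
  refine ⟨hmem.2 hR.isInitial.source, ?_, fun x hx ↦ ?_⟩
  · exact Option.eq_none_iff_forall_ne_some.2 fun p hp ↦
      not_isPred_source (isWeight_bandWeight I E) p
        (((h.isFinal (hR.lt_top _ hR.isInitial.source)).parent p).1 hp)
  · rw [hmem] at hx
    obtain ⟨P, hP⟩ := exists_isShortestPath_iff.2 (hR.lt_top x hx)
    refine ⟨P, hk.isShortestPath hw (hR.isShortestPath hP (hR.le_target x hx))
      ((hR.mem_iff_forall_known hP).1 hx), fun y hy ↦ ?_, ?_⟩
    · exact hmem.2 (hR.isInitial.mem_of_isAncestor (hP.isAncestor hy) hx)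
    · exact hP.isChain_isPred.imp fun a b hab ↦ ((h.isFinal hab.2.2).parent a).2 hab

end SearchTree

section Iteration

variable {V : Type u} [DecidableEq V] {I : Input V} {Ev : Set V} {E : Finset (V × V)}
  {known : V × V → Option ℝ≥0∞} {s : LRAState V} {e : V × V} {P : List V}

lemma Stable.top_eq (h : Stable I Ev E s)
    (ht : sourceDist I (bandWeight I E) I.target < ∞) : s.top I s.Qfrontier = I.target :=
  ((h.frontier _).1 (top_mem I s ⟨I.target, (h.frontier _).2 ⟨rfl, (h.mem_T _).2 ht⟩⟩)).1

lemma Stable.nextEdge_eq [Fintype V] (h : Stable I Ev E s) (hR : Reflects I known E Ev)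
    (hP : IsShortestPath I (bandWeight I E) I.target P) :
    s.nextEdge I = (pathEdges P).find? fun e ↦ (known e).isNone := by
  rw [nextEdge, h.top_eq hP.sourceDist_lt_top, h.isSearchTree.pathTo hP]
  refine List.find?_congr fun e he ↦ ?_
  have hb := (h.isSearchTree.isFinal (hP.isPred he).2.2).b_eq_zero
  rw [Bool.eq_iff_iff]
  simpa [hb, Option.isNone_iff_eq_none] using
    (not_congr (hR.known_ne_none_iff (hP.isPred he))).symm

lemma Stable.act_of_nextEdge [Fintype V] (h : Stable I Ev E s)
    (ht : sourceDist I (bandWeight I E) I.target < ∞) (he : s.nextEdge I = some e) :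
    s.act I = .eval e := by
  have hQ : s.Qfrontier ≠ ∅ :=
    Finset.ne_empty_of_mem ((h.frontier I.target).2 ⟨rfl, (h.mem_T _).2 ht⟩)
  simp [act, h.quiet.result, hQ, he]

lemma Stable.act_of_sourceDist_eq_top [Fintype V] (h : Stable I Ev E s)
    (ht : sourceDist I (bandWeight I E) I.target = ∞) : s.act I = .report none := by
  have hQ : s.Qfrontier = ∅ := by
    refine Finset.eq_empty_of_forall_notMem fun x hx ↦ ?_
    obtain ⟨rfl, hxT⟩ := (h.frontier x).1 hx
    exact ((h.mem_T _).1 hxT).ne ht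
  simp [act, h.quiet.result, hQ]

lemma Stable.exists_isNext [Fintype V] (h : Stable I Ev E s) (hR : Reflects I known E Ev)
    (htEv : I.target ∉ Ev) (ht : sourceDist I (bandWeight I E) I.target < ∞) :
    ∃ e, IsNext I E Ev e ∧ s.nextEdge I = some e ∧ s.act I = .eval e ∧
      lazySPAction I known = .eval e := by
  obtain ⟨P, hP⟩ := exists_isShortestPath_iff.2 ht
  obtain ⟨e, hfind, he⟩ := hR.exists_isNext hP htEv
  have hnext : s.nextEdge I = some e := (h.nextEdge_eq hR hP).trans hfind
  refine ⟨e, he, hnext, h.act_of_nextEdge ht hnext, ?_⟩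
  rw [lazySPAction_of_isShortestPath hR.isWeight (hR.isShortestPath hP le_rfl), hfind]
  rfl

/-- The state in which `e` has been found to be collision-free, and the entries of the descendants
of `e.2` are still to be updated. -/
noncomputable def markFree (I : Input V) (s : LRAState V) (e : V × V) : LRAState V :=
  { s with
    node := Function.update s.node e.2 ⟨some e.1, (s.node e.1).c + I.lazyW e, 0, 0⟩
    Qfrontier := ∅
    Qupdate := {e.2} }

/-- The state in which `e` has been found to be in collision, and the nodes of the descendants of
`e.2` are still to be rewired. -/
noncomputable def markCollision (s : LRAState V) (e : V × V) : LRAState V :=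
  { s with Qfrontier := ∅, E := s.E.erase e, Trewire := s.subtree e.2 }

lemma Stable.erase_top_Qfrontier (h : Stable I Ev E s)
    (ht : sourceDist I (bandWeight I E) I.target < ∞) :
    s.Qfrontier.erase (s.top I s.Qfrontier) = ∅ := by
  rw [h.top_eq ht]
  exact Finset.eq_empty_of_forall_notMem fun x hx ↦
    (Finset.mem_erase.1 hx).1 ((h.frontier x).1 (Finset.mem_erase.1 hx).2).1

lemma Stable.iteration_lazyW [Fintype V] (h : Stable I Ev E s)
    (ht : sourceDist I (bandWeight I E) I.target < ∞) (he : s.nextEdge I = some e) :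
    s.iteration I ⊤ (I.lazyW e) =
      if I.target = e.2 then
        { s.markFree I e with result := some ((s.markFree I e).pathTo I.target) }
      else extendBand I ⊤ (rewireBand I ⊤ (updateBand I ⊤ (s.markFree I e))) := by
  simp [LRAState.iteration, he, h.erase_top_Qfrontier ht, evaluate, setNode, h.quiet.Qupdate,
    markFree]

lemma Stable.iteration_top [Fintype V] (h : Stable I Ev E s)
    (ht : sourceDist I (bandWeight I E) I.target < ∞) (he : s.nextEdge I = some e) :
    s.iteration I ⊤ ∞ = extendBand I ⊤ (rewireBand I ⊤ (s.markCollision e)) := by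
  have hupdate : updateBand I ⊤ (s.markCollision e) = s.markCollision e :=
    whileLoop_of_not (by simp [markCollision, h.quiet.Qupdate])
  rw [← hupdate]
  simp [LRAState.iteration, he, h.erase_top_Qfrontier ht, evaluate, h.quiet.Qupdate,
    markCollision]
  rfl

lemma Stable.isSearchTree_markFree [Finite V] (h : Stable I Ev E s) (he : IsNext I E Ev e) :
    IsSearchTree I (insert e.2 Ev) E (s.markFree I e) where
  mem_T := h.mem_T
  final x hx := by
    rcases eq_or_ne x e.2 with rfl | hxe
    · simpa [markFree] using he.isPred.isFinal_insert (isWeight_bandWeight I E)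
        (h.isSearchTree.isFinal he.isPred.sourceDist_fst_lt_top) he.fst_mem
    · simpa [markFree, hxe] using (h.final x hx).insert_of_ne hxe

lemma Stable.updateInv_markFree [Finite V] (h : Stable I Ev E s) (hEv : IsInitial I Ev E)
    (he : IsNext I E Ev e) : UpdateInv I (insert e.2 Ev) E ∅ (s.markFree I e) := by
  have htree := h.isSearchTree_markFree he
  have hqueue : (s.markFree I e).Qupdate ∪ (s.markFree I e).Qextend = {e.2} := by
    simp [markFree, h.Qextend]
  constructor
  case E_eq => exact h.quiet.E_eq
  case result => exact h.quiet.result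
  case Qrewire => exact h.quiet.Qrewire
  case Trewire => exact h.quiet.Trewire
  case Qfrontier => rfl
  case mem_T => exact htree.mem_T
  case le_key =>
    intro x
    rcases eq_or_ne x e.2 with rfl | hxe
    · exact (htree.isFinal he.isPred.2.2).key.ge
    · simpa [markFree, hxe] using h.le_key x
  case final => exact htree.final
  case subset =>
    rw [hqueue, Finset.singleton_subset_iff]
    exact (h.mem_T e.2).2 he.isPred.2.2
  case notMem_evaluated =>
    simp only [hqueue, Finset.mem_singleton, forall_eq]
    rintro x hex (rfl | hx)
    · exact lt_irrefl _ (hex.sourceDist_lt (isWeight_bandWeight I E))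
    · exact he.snd_notMem (hEv.closed _ _ hex hx)
  case target => exact Or.inr ⟨e.2, Or.inl (Finset.mem_singleton_self _), he.isAncestor⟩

lemma rewireBand_of_empty (hQ : s.Qrewire = ∅) (hT : s.Trewire = ∅) :
    rewireBand I ⊤ s = s := by
  have hloop : whileLoop (fun s ↦ s.Qrewire.Nonempty) (rewireBody I ⊤) s = s :=
    whileLoop_of_not (by simp [hQ])
  cases s
  simp_all [rewireBand]

lemma Stable.updateBand_markFree [Fintype V] (h : Stable I Ev E s) (hR : Reflects I known E Ev)
    (he : IsNext I E Ev e) :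
    Stable I (insert e.2 Ev) E
      (extendBand I ⊤ (rewireBand I ⊤ (updateBand I ⊤ (s.markFree I e)))) := by
  have hR' := hR.insert he
  have hinv := (h.updateInv_markFree hR.isInitial he).extendInv_updateBand hR'.subset
    hR'.isInitial hR'.lt_top
  rw [rewireBand_of_empty hinv.quiet.Qrewire hinv.quiet.Trewire]
  exact hinv.stable_extendBand hR'.subset hR'.isInitial

lemma Stable.rewireBand_markCollision [Fintype V] (h : Stable I Ev E s)
    (hR : Reflects I known E Ev) (he : IsNext I E Ev e) :
    Stable I Ev (E.erase e) (extendBand I ⊤ (rewireBand I ⊤ (s.markCollision e))) := by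
  have hR' := hR.erase he.isPred.1 he.snd_notMem
  rw [markCollision, h.quiet.E_eq]
  exact (h.extendInv_rewireBand hR.subset hR.isInitial hR.lt_top he.snd_notMem
    he.isAncestor).stable_extendBand hR'.subset hR'.isInitial

end Iteration

end LRAState

section Simulation

variable {V : Type u} [DecidableEq V] {I : Input V} {w : V × V → ℝ≥0∞}
  {known : V × V → Option ℝ≥0∞} {s : LRAState V} {e : V × V}

namespace LRAState

variable (I known s) in
/-- The simulation relation between the states of LazySP and of LRA*: either LRA* is about to
continue its search, or it has found the path that LazySP reports. -/
def Related : Prop :=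
  ∃ E Ev, Reflects I known E Ev ∧ IsSearchTree I Ev E s ∧
    ((I.target ∉ Ev ∧ Stable I Ev E s) ∨
      I.target ∈ Ev ∧ ∃ P, IsShortestPath I (bandWeight I E) I.target P ∧ s.result = some P)

lemma Stable.related {E : Finset (V × V)} {Ev : Set V} (h : Stable I Ev E s)
    (hR : Reflects I known E Ev) (ht : I.target ∉ Ev) : Related I known s :=
  ⟨E, Ev, hR, h.isSearchTree, Or.inl ⟨ht, h⟩⟩

lemma Related.isShortestPathTree [Finite V] (h : Related I known s) (hk : Agrees I w known)
    (hw : IsWeight I w) : IsShortestPathTree I w s.evaluatedTree := by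
  obtain ⟨E, Ev, hR, hs, -⟩ := h
  exact hs.isShortestPathTree_evaluatedTree hR hk hw

variable [Fintype V]

lemma related_start : Related I (fun _ ↦ none) (start I ⊤) :=
  (stable_start I).related reflects_none I.source_ne_target.symm

lemma Related.act_eq (h : Related I known s) : s.act I = lazySPAction I known := by
  obtain ⟨E, Ev, hR, -, ⟨htEv, hs⟩ | ⟨htEv, P, hP, hres⟩⟩ := h
  · rcases eq_or_ne (sourceDist I (bandWeight I E) I.target) ∞ with ht | ht
    · rw [hs.act_of_sourceDist_eq_top ht, hR.lazySPAction_of_sourceDist_eq_top ht]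
    · obtain ⟨e, -, -, hact, hlazy⟩ := hs.exists_isNext hR htEv ht.lt_top
      rw [hact, hlazy]
  · rw [hR.lazySPAction_of_target_mem hP htEv, act, hres]

lemma Related.exists_stable (h : Related I known s) (he : s.act I = .eval e) :
    ∃ E Ev, Reflects I known E Ev ∧ Stable I Ev E s ∧ I.target ∉ Ev ∧
      sourceDist I (bandWeight I E) I.target < ∞ ∧ IsNext I E Ev e ∧ s.nextEdge I = some e := by
  obtain ⟨E, Ev, hR, -, ⟨htEv, hs⟩ | ⟨-, P, -, hres⟩⟩ := h
  · have ht : sourceDist I (bandWeight I E) I.target < ∞ := lt_top_iff_ne_top.2 fun ht ↦ by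
      simp [hs.act_of_sourceDist_eq_top ht] at he
    obtain ⟨f, hf, hnext, hact, -⟩ := hs.exists_isNext hR htEv ht
    obtain rfl : f = e := by simpa [hact] using he
    exact ⟨E, Ev, hR, hs, htEv, ht, hf, hnext⟩
  · simp [act, hres] at he

lemma Related.fst_mem (h : Related I known s) (he : s.act I = .eval e) :
    e.1 ∈ s.evaluatedTree.verts := by
  obtain ⟨E, Ev, hR, hs, -, -, hnext, -⟩ := h.exists_stable he
  exact (hs.isSearchTree.mem_evaluatedTree_iff hR.lt_top).2 hnext.fst_mem

lemma Related.iteration_lazyW (h : Related I known s) (he : s.act I = .eval e) :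
    Related I (Function.update known e (some (I.lazyW e : ℝ≥0∞)))
      (s.iteration I ⊤ (I.lazyW e)) := by
  obtain ⟨E, Ev, hR, hs, htEv, ht, hnext, hedge⟩ := h.exists_stable he
  rw [hs.iteration_lazyW ht hedge]
  split_ifs with htarget
  · obtain ⟨P, hP⟩ := exists_isShortestPath_iff.2 ht
    have htree := hs.isSearchTree_markFree hnext
    exact ⟨E, insert e.2 Ev, hR.insert hnext, ⟨htree.mem_T, htree.final⟩,
      Or.inr ⟨Or.inl htarget, P, hP, congrArg some (htree.pathTo hP)⟩⟩
  · exact (hs.updateBand_markFree hR hnext).related (hR.insert hnext)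
      (not_or.2 ⟨htarget, htEv⟩)

lemma Related.iteration_top (h : Related I known s) (he : s.act I = .eval e) :
    Related I (Function.update known e (some ∞)) (s.iteration I ⊤ ∞) := by
  obtain ⟨E, Ev, hR, hs, htEv, ht, hnext, hedge⟩ := h.exists_stable he
  rw [hs.iteration_top ht hedge]
  exact (hs.rewireBand_markCollision hR hnext).related
    (hR.erase hnext.isPred.1 hnext.snd_notMem) htEv

end LRAState

open LRAState

variable [Fintype V]

lemma related_stateAt (hw : IsWeight I w) (n : ℕ) :
    Related I (lazySPKnown I w n) ((LRAstar V ⊤).stateAt I w n) := by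
  induction n with
  | zero => exact related_start
  | succ n ih =>
    have hact : (LRAstar V ⊤).action I ((LRAstar V ⊤).stateAt I w n) =
        lazySPAction I (lazySPKnown I w n) := ih.act_eq
    cases hlazy : lazySPAction I (lazySPKnown I w n) with
    | eval e =>
      have heval := hact.trans hlazy
      rw [lazySPKnown_succ_of_eval hlazy, Algorithm.stateAt_succ_of_eval heval]
      rcases hw e (mem_edges_and_eq_none_of_lazySPAction_eq_eval hlazy).1 with hfree | hcol
      · rw [hfree]
        exact ih.iteration_lazyW heval
      · rw [hcol]
        exact ih.iteration_top heval
    | report r =>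
      rwa [lazySPKnown_succ_of_report hlazy,
        Algorithm.stateAt_succ_of_report (hact.trans hlazy)]

lemma LRAstar_action_eq (hw : IsWeight I w) (n : ℕ) :
    (LRAstar V ⊤).action I ((LRAstar V ⊤).stateAt I w n) = lazySPAction I (lazySPKnown I w n) :=
  (related_stateAt hw n).act_eq

theorem inSP_LRAstar : InSP (LRAstar V ⊤) := by
  obtain ⟨_, hlazySP⟩ := inSP_lazySP (V := V)
  refine ⟨fun _ ↦ evaluatedTree, fun I w hw ↦ ?_⟩
  obtain ⟨-, hmem, hreport, hsome, hnone⟩ := hlazySP I w hw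
  refine ⟨fun n ↦ (related_stateAt hw n).isShortestPathTree (agrees_lazySPKnown n) hw,
    fun n e he ↦ ⟨?_, (related_stateAt hw n).fst_mem he⟩, ?_, fun n P h ↦ ?_, fun n h ↦ ?_⟩
  · exact (hmem n e ((LRAstar_action_eq hw n).symm.trans he)).1
  · exact hreport.imp fun n ⟨r, h⟩ ↦ ⟨r, (LRAstar_action_eq hw n).trans h⟩
  · exact hsome n P ((LRAstar_action_eq hw n).symm.trans h)
  · exact hnone n ((LRAstar_action_eq hw n).symm.trans h)

theorem edgeOptimal_LRAstar : EdgeOptimal (LRAstar V ⊤) :=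
  edgeOptimal_of_action_eq inSP_LRAstar fun _ _ hw ↦ LRAstar_action_eq hw

end Simulation

end LazySearch

theorem mainTheorem1 (V : Type u) [Fintype V] [DecidableEq V] :
    LazySearch.EdgeOptimal (LazySearch.LRAstar V ⊤) ∧
    LazySearch.EdgeOptimal (LazySearch.lazySP V) := by
  exact ⟨LazySearch.edgeOptimal_LRAstar, LazySearch.edgeOptimal_lazySP⟩
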